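/- \textbf{Setting.} Let $(\mathcal S,\mathcal A,R,P,p_0,\gamma)$ be an MDP: $\mathcal S$ is a measurable space with a $\sigma$-finite reference measure $\nu$ (e.g. a region of $\mathbb R^n$ with Lebesgue measure), $\mathcal A\subseteq\mathbb R^m$ is open, $R:\mathcal S\times\mathcal A\times\mathcal S\to[0,\bar R]$ is measurable, $P(\cdot\mid s,a)$ is a jointly measurable probability density with respect to $\nu$, $p_0$ is a probability law of the initial state, and $0<\gamma<1$. An extended deterministic policy is a measurable map $\hat\mu:\mathcal S\times\mathbb R\to\mathcal A$. It drives the extended process $$a_t=\hat\mu(s_t,y_t),\qquad s_{t+1}\sim P(\cdot\mid s_t,a_t),\qquad r_{t+1}=R(s_t,a_t,s_{t+1}),\qquad y_{t+1}=\frac{r_{t+1}\lor y_t}{\gamma}.$$ With the max-reward return $\hat G_t=\max\{r_{t+1},\gamma r_{t+2},\gamma^2r_{t+3},\dots\}$ put $$\hat v^{\hat\mu}(s,y)=\mathbb E_{\hat\mu}[y\lor\hat G_0\mid s_0=s,y_0=y],\qquad \hat q^{\hat\mu}(s,a,y)=\mathbb E_{\hat\mu}[y\lor\hat G_0\mid s_0=s,a_0=a,y_0=y],\qquad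 \hat J(\hat\mu)=\mathbb E_{s_0\sim p_0}[\hat v^{\hat\mu}(s_0,0)],$$ and let $\hat d^{\hat\mu}=\sum_{t\ge0}\gamma^t\,\mathrm{Law}_{\hat\mu}(s_t,y_t)$, with $s_0\sim p_0$ and $y_0=0$, be the (unnormalized) discounted stationary distribution on $\mathcal S\times\mathbb R$. Let $(\hat\mu_{\theta'})_{\theta'\in\mathbb R^p}$ be a parameterized family of extended deterministic policies, write $\hat J(\theta')=\hat J(\hat\mu_{\theta'})$, and fix $\theta\in\mathbb R^p$. Assume the following regularity. \begin{enumerate} \item For all $s\in\mathcal S$ and $a\in\mathcal A$, for $\nu$-almost every $s'$, the functions $P(s'\mid s,\cdot)$ and $R(s,\cdot,s')$ are continuous at $a$. \item For every $s$ and $y$, the map $(\theta',y')\mapsto\hat\mu_{\theta'}(s,y')$ is continuous at $(\theta,y)$. \item There are $\varepsilon>0$ and $L$ such that for all $s\in\mathcal S$ and $y\in[0,\bar R]$: $\|\hat\mu_{\theta'}(s,y)-\hat\mu_\theta(s,y)\|\le L\|\theta'-\theta\|$ whenever $\|\theta'-\theta\|<\varepsilon$, and $|\hat q^{\hat\mu_\theta}(s,a,y)-\hat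 q^{\hat\mu_\theta}(s,\hat\mu_\theta(s,y),y)|\le L\|a-\hat\mu_\theta(s,y)\|$ whenever $a\in\mathcal A$ and $\|a-\hat\mu_\theta(s,y)\|<\varepsilon$. \item For $\hat d^{\hat\mu_\theta}$-almost every $(s,y)$: $\nabla_{\theta'}\hat\mu_{\theta'}(s,y')$ exists for all $(\theta',y')$ near $(\theta,y)$ and is continuous in $(\theta',y')$ at $(\theta,y)$, and $\nabla_a\hat q^{\hat\mu_\theta}(s,a,y')$ exists for all $(a,y')$ near $(\hat\mu_\theta(s,y),y)$ and is continuous in $(a,y')$ at $(\hat\mu_\theta(s,y),y)$. \end{enumerate} \textbf{Claim.} The measure $\hat d^{\hat\mu_\theta}$ has total mass $C=\frac1{1-\gamma}$, the function $(s,y)\mapsto\nabla_\theta\hat\mu_\theta(s,y)\,\nabla_a\hat q^{\hat\mu_\theta}(s,a,y)|_{a=\hat\mu_\theta(s,y)}$ is $\hat d^{\hat\mu_\theta}$-integrable, $\hat J$ is (Fréchet) differentiable at $\theta$, and $$\nabla_\theta\hat J(\theta)=\int\nabla_\theta\hat\mu_\theta(s,y)\,\nabla_a\hat q^{\hat\mu_\theta}(s,a,y)\big|_{a=\hat\mu_\theta(s,y)}\,d\hat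 d^{\hat\mu_\theta}(s,y)=C\;\mathbb E_{(s,y)\sim\hat d^{\hat\mu_\theta}/C}\Big[\nabla_\theta\hat\mu_\theta(s,y)\,\nabla_a\hat q^{\hat\mu_\theta}(s,a,y)\big|_{a=\hat\mu_\theta(s,y)}\Big].$$ In particular $\nabla_\theta\hat J(\theta)$ is proportional, with the positive constant $C$, to the expectation under the normalized distribution. Here $\nabla_\theta\hat\mu_\theta(s,y)$ is the $p\times m$ matrix whose columns are the gradients of the components of $\hat\mu_\theta(s,y)$. -/

import Mathlib

open MeasureTheory ProbabilityTheory Filter Topology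
open scoped ENNReal NNReal Gradient InnerProduct

/-- A Markov decision process with state space `S`, whose transition densities are taken with
respect to the reference measure `ν` (Lebesgue measure when `S` is a region of `ℝⁿ`), an action
space that is an open subset `act` of `ℝᵐ`, bounded non-negative rewards `R s a s'`, and a discount
factor in `(0, 1)`. The values of `R s a s'` and `P s a s'` matter only for `a ∈ act`. -/
structure MaxRewardMDP (S : Type*) [MeasurableSpace S] (ν : Measure S) (m : ℕ) where
  /-- the action space -/
  act : Set (EuclideanSpace ℝ (Fin m))
  isOpen_act : IsOpen act
  /-- the reward function -/
  R : S → EuclideanSpace ℝ (Fin m) → S → ℝ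
  measurable_R : Measurable fun z : S × EuclideanSpace ℝ (Fin m) × S => R z.1 z.2.1 z.2.2
  /-- the upper bound of the rewards -/
  Rbar : ℝ
  R_nonneg : ∀ s, ∀ a ∈ act, ∀ s', 0 ≤ R s a s'
  R_le : ∀ s, ∀ a ∈ act, ∀ s', R s a s' ≤ Rbar
  /-- `P s a` is the probability density of the next state given the state `s` and action `a` -/
  P : S → EuclideanSpace ℝ (Fin m) → S → ℝ≥0
  measurable_P : Measurable fun z : S × EuclideanSpace ℝ (Fin m) × S => P z.1 z.2.1 z.2.2
  lintegral_P : ∀ s, ∀ a ∈ act, ∫⁻ s', (P s a s' : ℝ≥0∞) ∂ν = 1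
  /-- the law of the initial state -/
  p₀ : Measure S
  isProbabilityMeasure_p₀ : IsProbabilityMeasure p₀
  /-- the discount factor -/
  γ : ℝ
  γ_pos : 0 < γ
  γ_lt_one : γ < 1

namespace MaxRewardMDP

/-- A deterministic extended max-reward policy: a measurable map from extended states `(s, y)` to
actions. -/
structure Policy {S : Type*} [MeasurableSpace S] {ν : Measure S} {m : ℕ}
    (M : MaxRewardMDP S ν m) where
  toFun : S × ℝ → EuclideanSpace ℝ (Fin m)
  measurable_toFun : Measurable toFun
  mem_act : ∀ x, toFun x ∈ M.act

instance {S : Type*} [MeasurableSpace S] {ν : Measure S} {m : ℕ} (M : MaxRewardMDP S ν m) :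
    CoeFun M.Policy (fun _ => S × ℝ → EuclideanSpace ℝ (Fin m)) := ⟨Policy.toFun⟩

/-- The law `P(· | s, a)` of the next state. -/
noncomputable def nextState {S : Type*} [MeasurableSpace S] {ν : Measure S} {m : ℕ}
    (M : MaxRewardMDP S ν m) (s : S) (a : EuclideanSpace ℝ (Fin m)) : Measure S :=
  ν.withDensity fun s' => (M.P s a s' : ℝ≥0∞)

/-- The updated auxiliary variable `y' = (R(s, a, s') ∨ y) / γ`. -/
noncomputable def nextAux {S : Type*} [MeasurableSpace S] {ν : Measure S} {m : ℕ}
    (M : MaxRewardMDP S ν m) (s : S) (y : ℝ) (a : EuclideanSpace ℝ (Fin m)) (s' : S) : ℝ :=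
  max (M.R s a s') y / M.γ

/-- The extended transition model: the law of `(s', y')` where `s'` has law `P(· | s, a)` and
`y' = (R(s, a, s') ∨ y) / γ`. -/
noncomputable def extTransition {S : Type*} [MeasurableSpace S] {ν : Measure S} {m : ℕ}
    (M : MaxRewardMDP S ν m) (s : S) (y : ℝ) (a : EuclideanSpace ℝ (Fin m)) : Measure (S × ℝ) :=
  (M.nextState s a).map fun s' => (s', M.nextAux s y a s')

theorem measurable_extTransition {S : Type*} [MeasurableSpace S] {ν : Measure S} [SigmaFinite ν]
    {m : ℕ} (M : MaxRewardMDP S ν m) (π : M.Policy) :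
    Measurable fun x : S × ℝ => M.extTransition x.1 x.2 (π x) := by
  have hπ := π.measurable_toFun
  have h₁ : Measurable fun z : (S × ℝ) × S => (z.1.1, π z.1, z.2) := by fun_prop
  have hR : Measurable fun z : (S × ℝ) × S => M.R z.1.1 (π z.1) z.2 := M.measurable_R.comp h₁
  have hP : Measurable fun z : (S × ℝ) × S => (M.P z.1.1 (π z.1) z.2 : ℝ≥0∞) :=
    (M.measurable_P.comp h₁).coe_nnreal_ennreal
  have hF : Measurable fun z : (S × ℝ) × S => (z.2, M.nextAux z.1.1 z.1.2 (π z.1) z.2) := by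
    unfold nextAux
    fun_prop
  refine Measure.measurable_of_measurable_coe _ fun B hB => ?_
  have key : ∀ x : S × ℝ, M.extTransition x.1 x.2 (π x) B =
      ∫⁻ s', ((fun z : (S × ℝ) × S => (z.2, M.nextAux z.1.1 z.1.2 (π z.1) z.2)) ⁻¹' B).indicator
        (fun z => (M.P z.1.1 (π z.1) z.2 : ℝ≥0∞)) (x, s') ∂ν := by
    intro x
    have hFx : Measurable fun s' : S => (s', M.nextAux x.1 x.2 (π x) s') :=
      hF.comp measurable_prodMk_left
    rw [extTransition, Measure.map_apply hFx hB, nextState,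
      withDensity_apply _ (hFx hB), ← lintegral_indicator (hFx hB)]
    rfl
  simp_rw [key]
  exact (hP.indicator (hF hB)).lintegral_prod_right'

/-- The on-policy extended transition model of a deterministic policy, as a Markov kernel. -/
noncomputable def onPolicy {S : Type*} [MeasurableSpace S] {ν : Measure S} [SigmaFinite ν]
    {m : ℕ} (M : MaxRewardMDP S ν m) (π : M.Policy) : Kernel (S × ℝ) (S × ℝ) where
  toFun x := M.extTransition x.1 x.2 (π x)
  measurable' := M.measurable_extTransition π

instance isMarkovKernel_onPolicy {S : Type*} [MeasurableSpace S] {ν : Measure S} [SigmaFinite ν]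
    {m : ℕ} (M : MaxRewardMDP S ν m) (π : M.Policy) : IsMarkovKernel (M.onPolicy π) := by
  refine ⟨fun x => ?_⟩
  have hF : Measurable fun s' : S => (s', M.nextAux x.1 x.2 (π x) s') := by
    have hR : Measurable fun s' : S => M.R x.1 (π x) s' :=
      M.measurable_R.comp (measurable_prodMk_left.comp measurable_prodMk_left)
    unfold nextAux
    fun_prop
  have h : IsProbabilityMeasure (M.nextState x.1 (π x)) := by
    refine ⟨?_⟩
    rw [nextState, withDensity_apply _ MeasurableSet.univ, Measure.restrict_univ]
    exact M.lintegral_P _ _ (π.mem_act x)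
  exact Measure.isProbabilityMeasure_map hF.aemeasurable

/-- The law of the infinite trajectory `(s₀, y₀), (s₁, y₁), …` of the extended process that starts
at `x = (s₀, y₀)` and follows the policy `π`. -/
noncomputable def trajLaw {S : Type*} [MeasurableSpace S] {ν : Measure S} [SigmaFinite ν]
    {m : ℕ} (M : MaxRewardMDP S ν m) (π : M.Policy) (x : S × ℝ) : Measure (ℕ → S × ℝ) :=
  Kernel.traj (X := fun _ : ℕ => S × ℝ)
    (fun n => (M.onPolicy π).comap
      (fun h : (i : Finset.Iic n) → S × ℝ => h ⟨n, Finset.mem_Iic.2 le_rfl⟩)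
      (measurable_pi_apply _)) 0 (fun _ => x)

/-- The max-reward return `Ĝ₀ = max {r₁, γ r₂, γ² r₃, …}` of a trajectory that follows `π`, where
`r_{t+1} = R(s_t, π(s_t, y_t), s_{t+1})`. -/
noncomputable def maxReturn {S : Type*} [MeasurableSpace S] {ν : Measure S} {m : ℕ}
    (M : MaxRewardMDP S ν m) (π : M.Policy) (ω : ℕ → S × ℝ) : ℝ :=
  ⨆ t : ℕ, M.γ ^ t * M.R (ω t).1 (π (ω t)) (ω (t + 1)).1

/-- The max-reward state value function `v̂(s, y) = E[y ∨ Ĝ₀ | s₀ = s, y₀ = y]`. -/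
noncomputable def vhat {S : Type*} [MeasurableSpace S] {ν : Measure S} [SigmaFinite ν]
    {m : ℕ} (M : MaxRewardMDP S ν m) (π : M.Policy) (s : S) (y : ℝ) : ℝ :=
  ∫ ω, max y (M.maxReturn π ω) ∂(M.trajLaw π (s, y))

/-- The max-reward state-action value function
`q̂(s, a, y) = E[y ∨ Ĝ₀ | s₀ = s, a₀ = a, y₀ = y]`: the first action is `a`, the policy `π` is
followed from the next extended state on, and `Ĝ₀ = r₁ ∨ γ Ĝ₁` with `r₁ = R(s, a, s₁)`. -/
noncomputable def qhat {S : Type*} [MeasurableSpace S] {ν : Measure S} [SigmaFinite ν]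
    {m : ℕ} (M : MaxRewardMDP S ν m) (π : M.Policy) (s : S) (a : EuclideanSpace ℝ (Fin m))
    (y : ℝ) : ℝ :=
  ∫ s', (∫ ω, max y (max (M.R s a s') (M.γ * M.maxReturn π ω))
    ∂(M.trajLaw π (s', M.nextAux s y a s'))) ∂(M.nextState s a)

/-- The objective `Ĵ(π) = E_{s₀ ∼ p₀}[v̂(s₀, 0)]`. -/
noncomputable def objective {S : Type*} [MeasurableSpace S] {ν : Measure S} [SigmaFinite ν]
    {m : ℕ} (M : MaxRewardMDP S ν m) (π : M.Policy) : ℝ :=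
  ∫ s, M.vhat π s 0 ∂M.p₀

/-- The initial law of `(s₀, y₀)`: `s₀ ∼ p₀` and `y₀ = 0`. -/
noncomputable def extInit {S : Type*} [MeasurableSpace S] {ν : Measure S} {m : ℕ}
    (M : MaxRewardMDP S ν m) : Measure (S × ℝ) :=
  M.p₀.map fun s => (s, (0 : ℝ))

/-- The `t`-step transition law `p̂_t(x, ·)` of the extended process under the policy `π`. -/
noncomputable def stepLaw {S : Type*} [MeasurableSpace S] {ν : Measure S} [SigmaFinite ν]
    {m : ℕ} (M : MaxRewardMDP S ν m) (π : M.Policy) : ℕ → Kernel (S × ℝ) (S × ℝ)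
  | 0 => Kernel.id
  | t + 1 => (M.onPolicy π) ∘ₖ (M.stepLaw π t)

/-- The (unnormalized) discounted stationary distribution
`d̂ = ∫ p̂₀(dx₀) ∑ₜ γᵗ p̂ₜ(x₀, ·)` on extended states. -/
noncomputable def dhat {S : Type*} [MeasurableSpace S] {ν : Measure S} [SigmaFinite ν]
    {m : ℕ} (M : MaxRewardMDP S ν m) (π : M.Policy) : Measure (S × ℝ) :=
  M.extInit.bind fun x₀ => Measure.sum fun t : ℕ => ENNReal.ofReal (M.γ ^ t) • M.stepLaw π t x₀

/-- The integrand `∇_θ μ_θ(s, y) ∇_a q̂^{μ_θ}(s, a, y)|_{a = μ_θ(s, y)}` of the deterministic policy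
gradient: the matrix `∇_θ μ_θ(s, y)`, with one column `∇_θ μ_θ(s, y)_j` for each action
coordinate `j`, is the adjoint of the derivative of `θ ↦ μ_θ(s, y)`. -/
noncomputable def gradIntegrand {S : Type*} [MeasurableSpace S] {ν : Measure S} [SigmaFinite ν]
    {m p : ℕ} (M : MaxRewardMDP S ν m) (μ : EuclideanSpace ℝ (Fin p) → M.Policy)
    (θ : EuclideanSpace ℝ (Fin p)) (x : S × ℝ) : EuclideanSpace ℝ (Fin p) :=
  ContinuousLinearMap.adjoint (fderiv ℝ (fun θ' => μ θ' x) θ)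
    (∇ (fun a => M.qhat (μ θ) x.1 a x.2) (μ θ x))

end MaxRewardMDP

/-! The auxiliary variable turns the nonlinear return into a linear one: `γ ^ t * y_t` is the
running maximum of `y` and the discounted rewards, so it increases to `y ∨ Ĝ₀` and `v̂` is the limit
of the expectations `γ ^ t * E[y_t]`. Conditioning on the first step gives a Bellman equation
without a reward term, `v̂(x) = γ E[v̂(x')]` (`extValue_eq`), and likewise `q̂ = γ E[v̂(x')]`
(`qhat_eq`).

Telescoping these equations along the process driven by the perturbed policy yields the performance
difference formula (`objective_sub_eq_tsum`): the change of the objective is the discounted sum of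
expected advantages. After division by `‖θ' - θ‖` the advantages are uniformly bounded on `y ≥ 0`:
the Lipschitz hypotheses cover `y ≤ Rbar`, and above `Rbar` the value is `y` whatever the action.

Pointwise, the quotients tend to the chain-rule derivative in the limiting direction. They are
integrated, however, against laws that move with the policy. Scheffé's lemma controls the state
densities, but `y_t` may have atoms that move, so convergence must tolerate perturbations of `y`;
`TendstoAlongSnd` is the mode of convergence that passes through each transition
(`tendsto_integral_stateLaw`). Compactness of the unit sphere then upgrades limits along converging
directions to Fréchet differentiability. -/

namespace MaxRewardMDP

/-! ### Bounds and measurability for rewards, returns and one transition. -/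

section Reward

variable {S : Type*} [MeasurableSpace S] {ν : Measure S} {m : ℕ}
  (M : MaxRewardMDP S ν m) (π : M.Policy)

lemma measurable_R_policy :
    Measurable fun z : (S × ℝ) × (S × ℝ) => M.R z.1.1 (π z.1) z.2.1 := by
  have hπ := π.measurable_toFun
  have h : Measurable fun z : (S × ℝ) × (S × ℝ) => (z.1.1, π z.1, z.2.1) := by fun_prop
  exact M.measurable_R.comp h

lemma measurable_nextAux (s : S) (y : ℝ) (a : EuclideanSpace ℝ (Fin m)) :
    Measurable fun s' => M.nextAux s y a s' := by
  have h : Measurable fun s' : S => (s, a, s') := by fun_prop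
  have hR : Measurable fun s' : S => M.R s a s' := M.measurable_R.comp h
  unfold nextAux
  fun_prop

lemma measurable_nextAux_policy :
    Measurable fun z : (S × ℝ) × (S × ℝ) => M.nextAux z.1.1 z.1.2 (π z.1) z.2.1 := by
  have hR := M.measurable_R_policy π
  unfold nextAux
  fun_prop

lemma isProbabilityMeasure_nextState (s : S) {a : EuclideanSpace ℝ (Fin m)} (ha : a ∈ M.act) :
    IsProbabilityMeasure (M.nextState s a) := by
  refine ⟨?_⟩
  rw [nextState, withDensity_apply _ MeasurableSet.univ, Measure.restrict_univ]
  exact M.lintegral_P _ _ ha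

lemma isProbabilityMeasure_extTransition (s : S) (y : ℝ) {a : EuclideanSpace ℝ (Fin m)}
    (ha : a ∈ M.act) : IsProbabilityMeasure (M.extTransition s y a) := by
  have := M.isProbabilityMeasure_nextState s ha
  exact Measure.isProbabilityMeasure_map
    (measurable_id.prodMk (M.measurable_nextAux s y a)).aemeasurable

lemma reward_term_nonneg (ω : ℕ → S × ℝ) (t : ℕ) :
    0 ≤ M.γ ^ t * M.R (ω t).1 (π (ω t)) (ω (t + 1)).1 :=
  mul_nonneg (pow_nonneg M.γ_pos.le t) (M.R_nonneg _ _ (π.mem_act _) _)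

lemma reward_term_le (ω : ℕ → S × ℝ) (t : ℕ) :
    M.γ ^ t * M.R (ω t).1 (π (ω t)) (ω (t + 1)).1 ≤ M.Rbar :=
  (mul_le_of_le_one_left (M.R_nonneg _ _ (π.mem_act _) _)
    (pow_le_one₀ M.γ_pos.le M.γ_lt_one.le)).trans (M.R_le _ _ (π.mem_act _) _)

lemma bddAbove_reward_terms (ω : ℕ → S × ℝ) : BddAbove
    (Set.range fun t : ℕ => M.γ ^ t * M.R (ω t).1 (π (ω t)) (ω (t + 1)).1) :=
  ⟨M.Rbar, by rintro _ ⟨t, rfl⟩; exact M.reward_term_le π ω t⟩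

lemma maxReturn_nonneg (ω : ℕ → S × ℝ) : 0 ≤ M.maxReturn π ω :=
  (M.reward_term_nonneg π ω 0).trans (le_ciSup (M.bddAbove_reward_terms π ω) 0)

lemma maxReturn_le (ω : ℕ → S × ℝ) : M.maxReturn π ω ≤ M.Rbar :=
  ciSup_le (M.reward_term_le π ω)

lemma measurable_maxReturn : Measurable (M.maxReturn π) := by
  refine Measurable.iSup fun t => ?_
  exact ((M.measurable_R_policy π).comp
    (g := fun z : (S × ℝ) × (S × ℝ) => M.R z.1.1 (π z.1) z.2.1)
    (f := fun ω : ℕ → S × ℝ => (ω t, ω (t + 1))) (by fun_prop)).const_mul _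

lemma abs_max_maxReturn_le (y : ℝ) (ω : ℕ → S × ℝ) :
    ‖max y (M.maxReturn π ω)‖ ≤ |y| + M.Rbar := by
  have h₀ := M.maxReturn_nonneg π ω
  have h₁ := M.maxReturn_le π ω
  rw [Real.norm_eq_abs, abs_of_nonneg (h₀.trans (le_max_right _ _))]
  exact max_le (by linarith [le_abs_self y]) (by linarith [abs_nonneg y])

lemma abs_nextAux_le (s : S) (y : ℝ) {a : EuclideanSpace ℝ (Fin m)} (ha : a ∈ M.act) (s' : S) :
    |M.nextAux s y a s'| ≤ (|y| + M.Rbar) / M.γ := by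
  have h₀ := M.R_nonneg s a ha s'
  have h₁ := M.R_le s a ha s'
  rw [nextAux, abs_div, abs_of_pos M.γ_pos]
  refine div_le_div_of_nonneg_right ?_ M.γ_pos.le
  rw [abs_of_nonneg (h₀.trans (le_max_left _ _))]
  exact max_le (by linarith [abs_nonneg y]) (by linarith [le_abs_self y])

lemma ae_extTransition_snd (s : S) (y : ℝ) (a : EuclideanSpace ℝ (Fin m)) :
    ∀ᵐ x' ∂(M.extTransition s y a), x'.2 = M.nextAux s y a x'.1 := by
  have hn := M.measurable_nextAux s y a
  exact (ae_map_iff (measurable_id.prodMk hn).aemeasurable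
    (measurableSet_eq_fun measurable_snd (hn.comp measurable_fst))).2 (ae_of_all _ fun s' => rfl)

lemma ae_extTransition_abs_le (s : S) (y : ℝ) {a : EuclideanSpace ℝ (Fin m)} (ha : a ∈ M.act) :
    ∀ᵐ x' ∂(M.extTransition s y a), |x'.2| + M.Rbar ≤ (|y| + M.Rbar) / M.γ + M.Rbar := by
  filter_upwards [M.ae_extTransition_snd s y a] with x' hx'
  rw [hx']
  linarith [M.abs_nextAux_le s y ha x'.1]

lemma integral_extTransition (s : S) (y : ℝ) (a : EuclideanSpace ℝ (Fin m)) {f : S × ℝ → ℝ}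
    (hf : AEStronglyMeasurable f (M.extTransition s y a)) :
    ∫ x', f x' ∂(M.extTransition s y a) =
      ∫ s', f (s', M.nextAux s y a s') ∂(M.nextState s a) :=
  integral_map (measurable_id.prodMk (M.measurable_nextAux s y a)).aemeasurable hf

end Reward

/-! ### The trajectory law and its marginals. -/

section Trajectory

variable {S : Type*} [MeasurableSpace S] {ν : Measure S} [SigmaFinite ν] {m : ℕ}
  (M : MaxRewardMDP S ν m) (π : M.Policy)

lemma onPolicy_apply (x : S × ℝ) : M.onPolicy π x = M.extTransition x.1 x.2 (π x) := rfl

instance isProbabilityMeasure_trajLaw (x : S × ℝ) : IsProbabilityMeasure (M.trajLaw π x) := by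
  unfold trajLaw
  infer_instance

instance isMarkovKernel_stepLaw (t : ℕ) : IsMarkovKernel (M.stepLaw π t) := by
  induction t with
  | zero => unfold stepLaw; infer_instance
  | succ t ih => unfold stepLaw; infer_instance

/-- The recursive definition splits off the last step; the Bellman equation conditions on the first.
-/
lemma stepLaw_succ' (t : ℕ) : M.stepLaw π (t + 1) = M.stepLaw π t ∘ₖ M.onPolicy π := by
  induction t with
  | zero => simp [stepLaw]
  | succ t ih =>
    conv_lhs => rw [stepLaw, ih]
    rw [← Kernel.comp_assoc]
    rfl

/-- The trajectory law as a kernel in the initial extended state. -/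
noncomputable def trajKernel : Kernel (S × ℝ) (ℕ → S × ℝ) where
  toFun x := M.trajLaw π x
  measurable' := (Kernel.measurable _).comp (by fun_prop)

instance isMarkovKernel_trajKernel : IsMarkovKernel (M.trajKernel π) :=
  ⟨fun x => M.isProbabilityMeasure_trajLaw π x⟩

/-- Markov property: the trajectory kernel sees the whole history but depends only on its last
entry, so the history can be projected to time `t`. -/
lemma map_trajLaw_pair (x : S × ℝ) (t : ℕ) :
    (M.trajLaw π x).map (fun ω => (ω t, ω (t + 1))) =
      (M.trajLaw π x).map (fun ω => ω t) ⊗ₘ M.onPolicy π := by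
  have h := Kernel.partialTraj_compProd_eq_map_traj (X := fun _ : ℕ => S × ℝ)
    (κ := fun n => (M.onPolicy π).comap
      (fun h : (i : Finset.Iic n) → S × ℝ => h ⟨n, Finset.mem_Iic.2 le_rfl⟩)
      (measurable_pi_apply _)) (zero_le (a := t)) (x₀ := fun _ => x)
  rw [← Kernel.traj_map_frestrictLe_apply] at h
  have h₂ := congrArg (Measure.map (fun z : ((i : Finset.Iic t) → S × ℝ) × (S × ℝ) =>
    (z.1 ⟨t, Finset.mem_Iic.2 le_rfl⟩, z.2))) h
  rw [Measure.map_map (by fun_prop) (by fun_prop)] at h₂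
  refine Eq.trans h₂.symm ?_
  ext B hB
  have hpre : ∀ z : (i : Finset.Iic t) → S × ℝ,
      Prod.mk z ⁻¹' ((fun z : ((i : Finset.Iic t) → S × ℝ) × (S × ℝ) =>
        (z.1 ⟨t, Finset.mem_Iic.2 le_rfl⟩, z.2)) ⁻¹' B) =
      Prod.mk (z ⟨t, Finset.mem_Iic.2 le_rfl⟩) ⁻¹' B := fun z => rfl
  have hm := Kernel.measurable_kernel_prodMk_left (κ := M.onPolicy π) hB
  rw [Measure.map_apply (by fun_prop) hB,
    Measure.compProd_apply (hB.preimage (by fun_prop)), Measure.compProd_apply hB,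
    lintegral_map hm (measurable_pi_apply t)]
  simp_rw [hpre, Kernel.comap_apply]
  exact lintegral_map (f := fun z : (i : Finset.Iic t) → S × ℝ =>
    M.onPolicy π (z ⟨t, Finset.mem_Iic.2 le_rfl⟩) (Prod.mk (z ⟨t, Finset.mem_Iic.2 le_rfl⟩) ⁻¹' B))
    (hm.comp (measurable_pi_apply _)) (Preorder.measurable_frestrictLe t)

lemma map_trajLaw_eval (x : S × ℝ) (t : ℕ) :
    (M.trajLaw π x).map (fun ω => ω t) = M.stepLaw π t x := by
  induction t with
  | zero =>
    have h := Kernel.traj_map_frestrictLe_apply (X := fun _ : ℕ => S × ℝ)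
      (κ := fun n => (M.onPolicy π).comap
        (fun h : (i : Finset.Iic n) → S × ℝ => h ⟨n, Finset.mem_Iic.2 le_rfl⟩)
        (measurable_pi_apply _)) 0 0 (fun _ => x)
    have h₂ := congrArg (Measure.map (fun z : (i : Finset.Iic 0) → S × ℝ =>
      z ⟨0, Finset.mem_Iic.2 le_rfl⟩)) h
    rw [Measure.map_map (by fun_prop) (by fun_prop), Kernel.partialTraj_self, Kernel.id_apply] at h₂
    rw [stepLaw, Kernel.id_apply]
    exact h₂.trans (Measure.map_dirac' (measurable_pi_apply _) _)
  | succ t ih =>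
    have h := congrArg (Measure.map Prod.snd) (M.map_trajLaw_pair π x t)
    rw [Measure.map_map (by fun_prop) (by fun_prop)] at h
    rw [stepLaw, Kernel.comp_apply, ← ih, ← Measure.snd_compProd]
    exact h

lemma ae_trajLaw_zero (x : S × ℝ) : ∀ᵐ ω ∂(M.trajLaw π x), (ω 0).2 = x.2 := by
  have h : ∀ᵐ z ∂((M.trajLaw π x).map (fun ω => ω 0)), z.2 = x.2 := by
    rw [map_trajLaw_eval, stepLaw, Kernel.id_apply,
      ae_dirac_iff (measurableSet_eq_fun measurable_snd measurable_const)]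
  exact ae_of_ae_map (Measurable.aemeasurable (by fun_prop)) h

lemma ae_onPolicy_snd (x : S × ℝ) :
    ∀ᵐ x' ∂(M.onPolicy π x), x'.2 = M.nextAux x.1 x.2 (π x) x'.1 :=
  M.ae_extTransition_snd x.1 x.2 (π x)

lemma ae_trajLaw_succ (x : S × ℝ) (t : ℕ) : ∀ᵐ ω ∂(M.trajLaw π x),
    (ω (t + 1)).2 = M.nextAux (ω t).1 (ω t).2 (π (ω t)) (ω (t + 1)).1 := by
  have h : ∀ᵐ z ∂((M.trajLaw π x).map (fun ω => (ω t, ω (t + 1)))),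
      z.2.2 = M.nextAux z.1.1 z.1.2 (π z.1) z.2.1 := by
    rw [map_trajLaw_pair]
    refine Measure.ae_compProd_of_ae_ae (measurableSet_eq_fun (by fun_prop)
      (M.measurable_nextAux_policy π)) (ae_of_all _ fun z => M.ae_onPolicy_snd π z)
  exact ae_of_ae_map (by fun_prop) h

lemma integrable_max_maxReturn (y : ℝ) (x : S × ℝ) :
    Integrable (fun ω => max y (M.maxReturn π ω)) (M.trajLaw π x) :=
  Integrable.of_bound (measurable_const.max (M.measurable_maxReturn π)).aestronglyMeasurable _
    (ae_of_all _ (M.abs_max_maxReturn_le π y))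

/-- The discounted auxiliary variable converges to `y ∨ Ĝ₀` along almost every trajectory. -/
lemma ae_tendsto_discounted_aux (x : S × ℝ) : ∀ᵐ ω ∂(M.trajLaw π x),
    (∀ t, ‖M.γ ^ t * (ω t).2‖ ≤ |x.2| + M.Rbar) ∧
    Tendsto (fun t => M.γ ^ t * (ω t).2) atTop (𝓝 (max x.2 (M.maxReturn π ω))) := by
  filter_upwards [M.ae_trajLaw_zero π x, ae_all_iff.2 (M.ae_trajLaw_succ π x)] with ω h0 hs
  have hγ := M.γ_pos
  -- The extra factor `γ` cancels the division in `nextAux`, leaving the recursion of a running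
  -- maximum.
  have hstep : ∀ t, M.γ ^ (t + 1) * (ω (t + 1)).2 =
      max (M.γ ^ t * M.R (ω t).1 (π (ω t)) (ω (t + 1)).1) (M.γ ^ t * (ω t).2) := by
    intro t
    rw [hs t, nextAux, ← mul_max_of_nonneg _ _ (pow_nonneg hγ.le t), pow_succ]
    field_simp
  have hmono : Monotone fun t => M.γ ^ t * (ω t).2 :=
    monotone_nat_of_le_succ fun t => by rw [hstep]; exact le_max_right _ _
  have hle : ∀ t, M.γ ^ t * (ω t).2 ≤ max x.2 (M.maxReturn π ω) := by
    intro t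
    induction t with
    | zero => simp [h0]
    | succ t ih =>
      rw [hstep]
      exact max_le ((le_ciSup (M.bddAbove_reward_terms π ω) t).trans (le_max_right _ _)) ih
  have hge : ∀ t, x.2 ≤ M.γ ^ t * (ω t).2 := fun t => by
    simpa [h0] using hmono (zero_le (a := t))
  refine ⟨fun t => ?_, tendsto_atTop_isLUB hmono ⟨?_, ?_⟩⟩
  · have h₁ := M.maxReturn_le π ω
    have h₂ := M.maxReturn_nonneg π ω
    have h₃ := (hle t).trans (max_le_iff.2 ⟨(le_abs_self x.2).trans (b := |x.2|)
      (by linarith : |x.2| ≤ |x.2| + M.Rbar), by linarith [abs_nonneg x.2]⟩)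
    rw [Real.norm_eq_abs, abs_le]
    exact ⟨by linarith [hge t, neg_abs_le x.2], h₃⟩
  · rintro _ ⟨t, rfl⟩
    exact hle t
  · intro b hb
    refine max_le ?_ (ciSup_le fun t => ?_)
    · exact (hge 0).trans (hb ⟨0, rfl⟩)
    · refine le_trans ?_ (hb ⟨t + 1, rfl⟩)
      show _ ≤ M.γ ^ (t + 1) * (ω (t + 1)).2
      rw [hstep]
      exact le_max_left _ _

end Trajectory

/-! ### Value functions and the Bellman equation. -/

section Value

variable {S : Type*} [MeasurableSpace S] {ν : Measure S} [SigmaFinite ν] {m : ℕ}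
  (M : MaxRewardMDP S ν m) (π : M.Policy)

/-- The state value function as a function of the extended state. -/
noncomputable def extValue (x : S × ℝ) : ℝ := M.vhat π x.1 x.2

lemma stronglyMeasurable_extValue : StronglyMeasurable (M.extValue π) := by
  have h : StronglyMeasurable fun z : (S × ℝ) × (ℕ → S × ℝ) => max z.1.2 (M.maxReturn π z.2) :=
    ((measurable_snd.comp measurable_fst).max
      ((M.measurable_maxReturn π).comp measurable_snd)).stronglyMeasurable
  exact h.integral_kernel_prod_right' (κ := M.trajKernel π)

lemma norm_extValue_le (x : S × ℝ) : ‖M.extValue π x‖ ≤ |x.2| + M.Rbar := by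
  have h := norm_integral_le_of_norm_le_const (μ := M.trajLaw π x)
    (ae_of_all _ (M.abs_max_maxReturn_le π x.2))
  simpa [extValue, vhat] using h

lemma extValue_of_Rbar_le {x : S × ℝ} (hx : M.Rbar ≤ x.2) : M.extValue π x = x.2 := by
  have h : ∀ ω, max x.2 (M.maxReturn π ω) = x.2 := fun ω =>
    max_eq_left ((M.maxReturn_le π ω).trans hx)
  simp [extValue, vhat, h]

/-- Dominated convergence along trajectories. It expresses the value through expectations of a
single coordinate, to which Chapman–Kolmogorov applies. -/
lemma tendsto_discounted_stepLaw (x : S × ℝ) :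
    Tendsto (fun t => M.γ ^ t * ∫ z, z.2 ∂(M.stepLaw π t x)) atTop (𝓝 (M.extValue π x)) := by
  have h := M.ae_tendsto_discounted_aux π x
  have key : Tendsto (fun t => ∫ ω, M.γ ^ t * (ω t).2 ∂(M.trajLaw π x)) atTop
      (𝓝 (∫ ω, max x.2 (M.maxReturn π ω) ∂(M.trajLaw π x))) :=
    tendsto_integral_of_dominated_convergence (fun _ => |x.2| + M.Rbar)
      (fun t => (Measurable.aestronglyMeasurable (by fun_prop))) (integrable_const _)
      (fun t => h.mono fun ω hω => hω.1 t) (h.mono fun ω hω => hω.2)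
  refine key.congr fun t => ?_
  rw [integral_const_mul, ← map_trajLaw_eval, integral_map (Measurable.aemeasurable (by fun_prop))
    measurable_snd.aestronglyMeasurable]

lemma ae_stepLaw_norm_le (x : S × ℝ) (t : ℕ) :
    ∀ᵐ z ∂(M.stepLaw π t x), ‖M.γ ^ t * z.2‖ ≤ |x.2| + M.Rbar := by
  rw [← map_trajLaw_eval, ae_map_iff (Measurable.aemeasurable (by fun_prop))
    (measurableSet_le (by fun_prop) measurable_const)]
  exact (M.ae_tendsto_discounted_aux π x).mono fun ω hω => hω.1 t

lemma integrable_snd_stepLaw (x : S × ℝ) (t : ℕ) :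
    Integrable (fun z : S × ℝ => z.2) (M.stepLaw π t x) := by
  have h : Integrable (fun z : S × ℝ => M.γ ^ t * z.2) (M.stepLaw π t x) :=
    Integrable.of_bound (Measurable.aestronglyMeasurable (by fun_prop)) _
      (M.ae_stepLaw_norm_le π x t)
  exact (integrable_const_mul_iff (pow_pos M.γ_pos t).ne'.isUnit _).1 h

lemma norm_discounted_stepLaw_le (x : S × ℝ) (t : ℕ) :
    ‖M.γ ^ t * ∫ z, z.2 ∂(M.stepLaw π t x)‖ ≤ |x.2| + M.Rbar := by
  rw [← integral_const_mul]
  simpa using norm_integral_le_of_norm_le_const (M.ae_stepLaw_norm_le π x t)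

lemma integrable_extValue_extTransition (s : S) (y : ℝ) {a : EuclideanSpace ℝ (Fin m)}
    (ha : a ∈ M.act) : Integrable (M.extValue π) (M.extTransition s y a) := by
  have := M.isProbabilityMeasure_extTransition s y ha
  refine Integrable.of_bound (M.stronglyMeasurable_extValue π).aestronglyMeasurable
    ((|y| + M.Rbar) / M.γ + M.Rbar) ?_
  filter_upwards [M.ae_extTransition_abs_le s y ha] with x' hx'
  exact (M.norm_extValue_le π x').trans hx'

/-- The Bellman equation. -/
lemma extValue_eq (x : S × ℝ) :
    M.extValue π x = M.γ * ∫ x', M.extValue π x' ∂(M.onPolicy π x) := by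
  -- Both sides are limits of the same sequence, `γ ^ (t + 1) * E[y_{t+1}]`, once the first of the
  -- `t + 1` steps is split off.
  have h₁ := (tendsto_add_atTop_iff_nat 1).2 (M.tendsto_discounted_stepLaw π x)
  have h₂ : Tendsto (fun t => M.γ * ∫ x', M.γ ^ t * ∫ z, z.2 ∂(M.stepLaw π t x')
      ∂(M.onPolicy π x)) atTop (𝓝 (M.γ * ∫ x', M.extValue π x' ∂(M.onPolicy π x))) := by
    refine Tendsto.const_mul _ (tendsto_integral_of_dominated_convergence
      (fun _ => (|x.2| + M.Rbar) / M.γ + M.Rbar) (fun t => ?_) (integrable_const _) (fun t => ?_)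
      (ae_of_all _ (M.tendsto_discounted_stepLaw π)))
    · have h : StronglyMeasurable fun z : (S × ℝ) × (S × ℝ) => z.2.2 :=
        (measurable_snd.comp measurable_snd).stronglyMeasurable
      exact (h.integral_kernel_prod_right' (κ := M.stepLaw π t)).aestronglyMeasurable.const_mul _
    · filter_upwards [M.ae_extTransition_abs_le x.1 x.2 (π.mem_act x)] with x' hx'
      exact (M.norm_discounted_stepLaw_le π x' t).trans hx'
  refine tendsto_nhds_unique h₁ (h₂.congr fun t => ?_)
  have hi := M.integrable_snd_stepLaw π x (t + 1)
  rw [stepLaw_succ'] at hi ⊢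
  rw [Kernel.integral_comp hi, integral_const_mul, pow_succ]
  ring

/-- Since `γ y' = R ∨ y`, the reward is already stored in the next auxiliary variable: `γ (y' ∨ Ĝ₁)
= y ∨ R ∨ γ Ĝ₁`. -/
lemma qhat_eq (s : S) (a : EuclideanSpace ℝ (Fin m)) (y : ℝ) :
    M.qhat π s a y = M.γ * ∫ x', M.extValue π x' ∂(M.extTransition s y a) := by
  have hγ := M.γ_pos
  rw [M.integral_extTransition s y a (M.stronglyMeasurable_extValue π).aestronglyMeasurable,
    qhat, ← integral_const_mul]
  refine integral_congr_ae (ae_of_all _ fun s' => ?_)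
  simp only [extValue, vhat]
  rw [← integral_const_mul]
  refine integral_congr_ae (ae_of_all _ fun ω => ?_)
  have h : M.γ * M.nextAux s y a s' = max (M.R s a s') y := by
    rw [nextAux]
    field_simp
  simp only [mul_max_of_nonneg _ _ hγ.le, h]
  rw [max_left_comm, max_assoc]

lemma qhat_policy (x : S × ℝ) : M.qhat π x.1 (π x) x.2 = M.extValue π x := by
  rw [qhat_eq, extValue_eq]
  rfl

/-- No reward can exceed `y` any more, and the next auxiliary variable `y / γ` is again at least
`Rbar`. This makes the advantage vanish where the Lipschitz hypotheses say nothing. -/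
lemma qhat_of_Rbar_le (s : S) {a : EuclideanSpace ℝ (Fin m)} (ha : a ∈ M.act) {y : ℝ}
    (hy : M.Rbar ≤ y) : M.qhat π s a y = y := by
  have hγ := M.γ_pos
  have := M.isProbabilityMeasure_extTransition s y ha
  have h₀ : 0 ≤ M.Rbar := (M.R_nonneg s a ha s).trans (M.R_le s a ha s)
  have h : ∀ᵐ x' ∂(M.extTransition s y a), M.extValue π x' = y / M.γ := by
    filter_upwards [M.ae_extTransition_snd s y a] with x' hx'
    have hx : x'.2 = y / M.γ := by
      rw [hx', nextAux, max_eq_right ((M.R_le s a ha x'.1).trans hy)]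
    rw [extValue_of_Rbar_le, hx]
    rw [hx, le_div_iff₀ hγ]
    nlinarith [M.γ_lt_one]
  rw [qhat_eq, integral_congr_ae h, integral_const]
  simp
  field_simp

end Value

end MaxRewardMDP

lemma integral_measure_comp {α β : Type*} [MeasurableSpace α] [MeasurableSpace β] {μ : Measure α}
    {κ : Kernel α β} {f : β → ℝ} (hf : Integrable f (μ.bind κ)) :
    ∫ y, f y ∂(μ.bind κ) = ∫ x, ∫ y, f y ∂(κ x) ∂μ := by
  rw [Measure.comp_eq_comp_const_apply] at hf ⊢
  exact Kernel.integral_comp hf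

lemma integrable_integral_of_measure_comp {α β : Type*} [MeasurableSpace α] [MeasurableSpace β]
    {μ : Measure α} {κ : Kernel α β} {f : β → ℝ} (hf : Integrable f (μ.bind κ)) :
    Integrable (fun x => ∫ y, f y ∂(κ x)) μ := by
  rw [Measure.comp_eq_comp_const_apply] at hf
  exact hf.integral_comp

namespace MaxRewardMDP

/-! ### Laws of the extended state and the discounted distribution. -/

section StateLaw

variable {S : Type*} [MeasurableSpace S] {ν : Measure S} [SigmaFinite ν] {m : ℕ}
  (M : MaxRewardMDP S ν m) (π : M.Policy)

/-- The law of the extended state `(s_t, y_t)` at time `t`, with `s₀ ∼ p₀` and `y₀ = 0`. -/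
noncomputable def stateLaw (t : ℕ) : Measure (S × ℝ) := M.extInit.bind (M.stepLaw π t)

instance isProbabilityMeasure_extInit : IsProbabilityMeasure M.extInit := by
  have := M.isProbabilityMeasure_p₀
  exact Measure.isProbabilityMeasure_map (by fun_prop)

instance isProbabilityMeasure_stateLaw (t : ℕ) : IsProbabilityMeasure (M.stateLaw π t) := by
  unfold stateLaw
  infer_instance

lemma stateLaw_zero : M.stateLaw π 0 = M.extInit := by
  simp [stateLaw, stepLaw]

lemma stateLaw_succ (t : ℕ) : M.stateLaw π (t + 1) = (M.stateLaw π t).bind (M.onPolicy π) := by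
  rw [stateLaw, stateLaw, stepLaw, Measure.comp_assoc]

lemma ae_stateLaw_nonneg (t : ℕ) : ∀ᵐ x ∂(M.stateLaw π t), 0 ≤ x.2 := by
  induction t with
  | zero =>
    rw [stateLaw_zero, extInit, ae_map_iff (by fun_prop)
      (measurableSet_le measurable_const measurable_snd)]
    simp
  | succ t ih =>
    rw [stateLaw_succ]
    refine Measure.ae_comp_of_ae_ae (measurableSet_le measurable_const measurable_snd) ?_
    filter_upwards [ih] with x hx
    filter_upwards [M.ae_extTransition_snd x.1 x.2 (π x)] with x' hx'
    rw [hx', nextAux]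
    exact div_nonneg (hx.trans (le_max_right _ _)) M.γ_pos.le

lemma dhat_eq : M.dhat π =
    Measure.sum fun t : ℕ => ENNReal.ofReal (M.γ ^ t) • M.stateLaw π t := by
  have hk : Measurable fun x => Measure.sum fun t : ℕ =>
      ENNReal.ofReal (M.γ ^ t) • M.stepLaw π t x := by
    refine Measure.measurable_of_measurable_coe _ fun B hB => ?_
    simp_rw [Measure.sum_apply _ hB, Measure.smul_apply, smul_eq_mul]
    exact Measurable.tsum fun t =>
      ((M.stepLaw π t).measurable_coe hB).const_mul _
  ext B hB
  rw [dhat, Measure.bind_apply hB hk.aemeasurable]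
  simp_rw [Measure.sum_apply _ hB, Measure.smul_apply, smul_eq_mul]
  rw [lintegral_tsum fun t => (((M.stepLaw π t).measurable_coe hB).const_mul _).aemeasurable]
  refine tsum_congr fun t => ?_
  rw [lintegral_const_mul _ ((M.stepLaw π t).measurable_coe hB), stateLaw,
    Measure.bind_apply hB (Kernel.aemeasurable _)]

lemma dhat_univ : M.dhat π Set.univ = ENNReal.ofReal (1 - M.γ)⁻¹ := by
  rw [dhat_eq, Measure.sum_apply _ MeasurableSet.univ]
  simp only [Measure.smul_apply, measure_univ, smul_eq_mul, mul_one]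
  rw [← ENNReal.ofReal_tsum_of_nonneg (fun t => pow_nonneg M.γ_pos.le t)
    (summable_geometric_of_lt_one M.γ_pos.le M.γ_lt_one),
    tsum_geometric_of_lt_one M.γ_pos.le M.γ_lt_one]

instance isFiniteMeasure_dhat : IsFiniteMeasure (M.dhat π) :=
  ⟨by rw [dhat_univ]; exact ENNReal.ofReal_lt_top⟩

/-- All weights `γ ^ t` are positive, so a set is null for the sum exactly when it is null at each
time. -/
lemma ae_dhat_iff {p : S × ℝ → Prop} :
    (∀ᵐ x ∂(M.dhat π), p x) ↔ ∀ t, ∀ᵐ x ∂(M.stateLaw π t), p x := by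
  rw [dhat_eq, Measure.ae_sum_iff]
  refine forall_congr' fun t => ?_
  rw [Measure.ae_ennreal_smul_measure_iff]
  simpa using pow_pos M.γ_pos t

lemma integral_dhat {f : S × ℝ → ℝ} (hf : Integrable f (M.dhat π)) :
    ∫ x, f x ∂(M.dhat π) = ∑' t, M.γ ^ t * ∫ x, f x ∂(M.stateLaw π t) := by
  rw [dhat_eq] at hf ⊢
  rw [integral_sum_measure hf]
  refine tsum_congr fun t => ?_
  rw [integral_smul_measure, ENNReal.toReal_ofReal (pow_nonneg M.γ_pos.le t), smul_eq_mul]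

end StateLaw

/-! ### The performance difference lemma. -/

section PerformanceDifference

variable {S : Type*} [MeasurableSpace S] {ν : Measure S} [SigmaFinite ν] {m : ℕ}
  (M : MaxRewardMDP S ν m) (π π' : M.Policy)

/-- The advantage of following `π'` for one step and `π` afterwards over following `π`. -/
noncomputable def advantage (x : S × ℝ) : ℝ := M.qhat π x.1 (π' x) x.2 - M.extValue π x

lemma advantage_eq (x : S × ℝ) : M.advantage π π' x =
    M.γ * ∫ x', M.extValue π x' ∂(M.onPolicy π' x) - M.extValue π x := by
  rw [advantage, qhat_eq, onPolicy_apply]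

lemma measurable_advantage : Measurable (M.advantage π π') := by
  have h := M.stronglyMeasurable_extValue π
  have h₂ : StronglyMeasurable fun x => ∫ x', M.extValue π x' ∂(M.onPolicy π' x) :=
    (h.comp_measurable measurable_snd).integral_kernel_prod_right' (κ := M.onPolicy π')
  have h₃ : M.advantage π π' = fun x =>
      M.γ * ∫ x', M.extValue π x' ∂(M.onPolicy π' x) - M.extValue π x :=
    funext (M.advantage_eq π π')
  rw [h₃]
  exact (h₂.measurable.const_mul _).sub h.measurable

lemma extValue_mem_Icc {x : S × ℝ} (hx : 0 ≤ x.2) :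
    M.extValue π x ∈ Set.Icc x.2 (x.2 + M.Rbar) := by
  have hi := M.integrable_max_maxReturn π x.2 x
  constructor
  · calc x.2 = ∫ _, x.2 ∂(M.trajLaw π x) := by simp
      _ ≤ _ := integral_mono (integrable_const _) hi fun ω => le_max_left _ _
  · have h := (le_abs_self _).trans (M.norm_extValue_le π x)
    rwa [abs_of_nonneg hx] at h

/-- Both values lie in `[y, y + Rbar]`. The values themselves are unbounded in `y`, which may grow
like `γ ^ (-t)`, but their difference is uniformly bounded; the telescoping therefore works with
differences only. -/
lemma abs_extValue_sub_le {x : S × ℝ} (hx : 0 ≤ x.2) :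
    |M.extValue π' x - M.extValue π x| ≤ M.Rbar := by
  have h₁ := M.extValue_mem_Icc π hx
  have h₂ := M.extValue_mem_Icc π' hx
  rw [abs_le]
  exact ⟨by linarith [h₁.2, h₂.1], by linarith [h₂.2, h₁.1]⟩

lemma integrable_extValue_sub (t : ℕ) :
    Integrable (fun x => M.extValue π' x - M.extValue π x) (M.stateLaw π' t) :=
  Integrable.of_bound ((M.stronglyMeasurable_extValue π').sub
    (M.stronglyMeasurable_extValue π)).aestronglyMeasurable _
    ((M.ae_stateLaw_nonneg π' t).mono fun _ hx => M.abs_extValue_sub_le π π' hx)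

lemma objective_sub : M.objective π' - M.objective π =
    ∫ x, (M.extValue π' x - M.extValue π x) ∂(M.stateLaw π' 0) := by
  have := M.isProbabilityMeasure_p₀
  have hm : ∀ ρ : M.Policy, StronglyMeasurable fun s : S => M.extValue ρ (s, 0) := fun ρ =>
    (M.stronglyMeasurable_extValue ρ).comp_measurable measurable_prodMk_right
  have hi : ∀ ρ : M.Policy, Integrable (fun s : S => M.extValue ρ (s, 0)) M.p₀ := fun ρ =>
    Integrable.of_bound (hm ρ).aestronglyMeasurable M.Rbar
      (ae_of_all _ fun s => by simpa using M.norm_extValue_le ρ (s, 0))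
  have hD : AEStronglyMeasurable (fun x => M.extValue π' x - M.extValue π x)
      (M.p₀.map fun s => (s, (0 : ℝ))) :=
    ((M.stronglyMeasurable_extValue π').sub (M.stronglyMeasurable_extValue π)).aestronglyMeasurable
  rw [stateLaw_zero, extInit, integral_map (by fun_prop) hD]
  exact (integral_sub (hi π') (hi π)).symm

lemma integrable_extValue_onPolicy (x : S × ℝ) :
    Integrable (M.extValue π) (M.onPolicy π' x) :=
  M.integrable_extValue_extTransition π x.1 x.2 (π'.mem_act x)

/-- Adding and subtracting `v̂` of the new policy, which satisfies its own Bellman equation, turns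
the advantage into `D - γ E[D(x')]` for the difference `D` of the values. Weighted by `γ ^ t`, these
terms telescope. -/
lemma integral_advantage (t : ℕ) : ∫ x, M.advantage π π' x ∂(M.stateLaw π' t) =
    ∫ x, (M.extValue π' x - M.extValue π x) ∂(M.stateLaw π' t) -
      M.γ * ∫ x, (M.extValue π' x - M.extValue π x) ∂(M.stateLaw π' (t + 1)) := by
  have hi := M.integrable_extValue_sub π π' (t + 1)
  rw [stateLaw_succ] at hi ⊢
  rw [integral_measure_comp hi, ← integral_const_mul,
    ← integral_sub (M.integrable_extValue_sub π π' t)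
      ((integrable_integral_of_measure_comp hi).const_mul _)]
  refine integral_congr_ae (ae_of_all _ fun x => ?_)
  simp only
  rw [integral_sub (M.integrable_extValue_onPolicy π' π' x)
    (M.integrable_extValue_onPolicy π π' x), mul_sub, ← extValue_eq,
    advantage_eq]
  ring

/-- The performance difference lemma. -/
lemma objective_sub_eq_tsum {B : ℝ} (hB : ∀ x : S × ℝ, 0 ≤ x.2 → |M.advantage π π' x| ≤ B) :
    M.objective π' - M.objective π =
      ∑' t, M.γ ^ t * ∫ x, M.advantage π π' x ∂(M.stateLaw π' t) := by
  have hγ := M.γ_pos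
  set D : ℕ → ℝ := fun t => ∫ x, (M.extValue π' x - M.extValue π x) ∂(M.stateLaw π' t) with hD
  have hDle : ∀ t, ‖D t‖ ≤ M.Rbar := fun t => by
    simpa [hD] using norm_integral_le_of_norm_le_const (μ := M.stateLaw π' t)
      (f := fun x => M.extValue π' x - M.extValue π x)
      ((M.ae_stateLaw_nonneg π' t).mono fun _ hx => M.abs_extValue_sub_le π π' hx)
  have hA : ∀ t, ‖∫ x, M.advantage π π' x ∂(M.stateLaw π' t)‖ ≤ B := fun t => by
    simpa using norm_integral_le_of_norm_le_const (μ := M.stateLaw π' t)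
      (f := M.advantage π π') ((M.ae_stateLaw_nonneg π' t).mono fun x hx => hB x hx)
  have hgeo := summable_geometric_of_lt_one hγ.le M.γ_lt_one
  have hs : Summable fun t => M.γ ^ t * ∫ x, M.advantage π π' x ∂(M.stateLaw π' t) := by
    refine Summable.of_norm_bounded (hgeo.mul_right B) fun t => ?_
    rw [norm_mul, norm_pow, Real.norm_of_nonneg hγ.le]
    exact mul_le_mul_of_nonneg_left (hA t) (pow_nonneg hγ.le t)
  have hpart : ∀ n, ∑ t ∈ Finset.range n, M.γ ^ t * ∫ x, M.advantage π π' x ∂(M.stateLaw π' t) =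
      D 0 - M.γ ^ n * D n := by
    intro n
    induction n with
    | zero => simp
    | succ n ih =>
      rw [Finset.sum_range_succ, ih, integral_advantage, pow_succ]
      simp only [hD]
      ring
  -- The boundary term of the telescoping sum vanishes because `D` is bounded.
  have hlim : Tendsto (fun n => M.γ ^ n * D n) atTop (𝓝 0) := by
    refine squeeze_zero_norm (a := fun n => M.γ ^ n * M.Rbar) (fun n => ?_) ?_
    · rw [norm_mul, norm_pow, Real.norm_of_nonneg hγ.le]
      exact mul_le_mul_of_nonneg_left (hDle n) (pow_nonneg hγ.le n)
    · simpa using (tendsto_pow_atTop_nhds_zero_of_lt_one hγ.le M.γ_lt_one).mul_const M.Rbar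
  have h₁ := hs.hasSum.tendsto_sum_nat
  simp_rw [hpart] at h₁
  rw [objective_sub]
  exact tendsto_nhds_unique (by simpa using hlim.const_sub (D 0)) h₁

end PerformanceDifference

end MaxRewardMDP

/-! ### Limit tools: Scheffé's lemma and convergence under perturbation of the second coordinate. -/

lemma norm_integral_kernel_le {α β : Type*} [MeasurableSpace α] [MeasurableSpace β]
    (κ : Kernel α β) [IsMarkovKernel κ] {f : β → ℝ} {B : ℝ} (hB : ∀ x, ‖f x‖ ≤ B) (x : α) :
    ‖∫ z, f z ∂(κ x)‖ ≤ B := by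
  simpa using norm_integral_le_of_norm_le_const (μ := κ x) (ae_of_all _ hB)

/-- Scheffé's lemma for nonnegative functions of equal integral. -/
lemma tendsto_integral_abs_sub_of_integral_eq {α : Type*} [MeasurableSpace α] {ν : Measure α}
    {p : ℕ → α → ℝ} {q : α → ℝ} (hp : ∀ n, Integrable (p n) ν) (hq : Integrable q ν)
    (hp₀ : ∀ n x, 0 ≤ p n x) (heq : ∀ n, ∫ x, p n x ∂ν = ∫ x, q x ∂ν)
    (hlim : ∀ᵐ x ∂ν, Tendsto (fun n => p n x) atTop (𝓝 (q x))) :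
    Tendsto (fun n => ∫ x, |p n x - q x| ∂ν) atTop (𝓝 0) := by
  have hpos : ∀ n, Integrable (fun x => max (q x - p n x) 0) ν := fun n =>
    (hq.sub (hp n)).pos_part
  have habs : ∀ n, ∫ x, |p n x - q x| ∂ν = 2 * ∫ x, max (q x - p n x) 0 ∂ν := by
    intro n
    -- The last summand integrates to zero, and the positive part of `q - p n` is dominated by
    -- `|q|`, whereas `|p n - q|` has no evident dominating function.
    have h : ∀ x, |p n x - q x| = 2 * max (q x - p n x) 0 + (p n x - q x) := by
      intro x
      rcases le_total (q x) (p n x) with h | h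
      · rw [abs_of_nonneg (sub_nonneg.2 h), max_eq_right (sub_nonpos.2 h)]
        ring
      · rw [abs_of_nonpos (sub_nonpos.2 h), max_eq_left (sub_nonneg.2 h)]
        ring
    simp_rw [h]
    have hs : Integrable (fun x => p n x - q x) ν := (hp n).sub hq
    rw [integral_add ((hpos n).const_mul 2) hs, integral_sub (hp n) hq, heq n,
      sub_self, add_zero, integral_const_mul]
  simp_rw [habs]
  have hlim₀ : Tendsto (fun n => ∫ x, max (q x - p n x) 0 ∂ν) atTop (𝓝 (∫ _, (0 : ℝ) ∂ν)) := by
    refine tendsto_integral_of_dominated_convergence (fun x => |q x|)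
      (fun n => (hpos n).aestronglyMeasurable) hq.abs (fun n => ae_of_all _ fun x => ?_) ?_
    · rw [Real.norm_of_nonneg (le_max_right _ _)]
      exact max_le ((sub_le_self _ (hp₀ n x)).trans (le_abs_self _)) (abs_nonneg _)
    · filter_upwards [hlim] with x hx
      have h := (hx.const_sub (q x)).max (tendsto_const_nhds (x := (0 : ℝ)))
      simpa using h
  simpa using hlim₀.const_mul 2

/-- The functions `f n` converge to `g` at `x`, uniformly in the sequential sense under
perturbations of the second coordinate. -/
def TendstoAlongSnd {S F : Type*} [TopologicalSpace F] (f : ℕ → S × ℝ → F) (g : S × ℝ → F)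
    (x : S × ℝ) : Prop :=
  ∀ y : ℕ → ℝ, Tendsto y atTop (𝓝 x.2) → Tendsto (fun n => f n (x.1, y n)) atTop (𝓝 (g x))

lemma TendstoAlongSnd.tendsto {S F : Type*} [TopologicalSpace F] {f : ℕ → S × ℝ → F}
    {g : S × ℝ → F} {x : S × ℝ} (h : TendstoAlongSnd f g x) :
    Tendsto (fun n => f n x) atTop (𝓝 (g x)) :=
  h (fun _ => x.2) tendsto_const_nhds

/-- This supplies the measurability of the gradient integrand, which is not among the hypotheses. -/
lemma aestronglyMeasurable_of_tendstoAlongSnd {S : Type*} [MeasurableSpace S]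
    {f : ℕ → S × ℝ → ℝ} {g : S × ℝ → ℝ} {μ : Measure (S × ℝ)} (hf : ∀ n, Measurable (f n))
    (h : ∀ᵐ x ∂μ, TendstoAlongSnd f g x) : AEStronglyMeasurable g μ :=
  aestronglyMeasurable_of_tendsto_ae atTop (fun n => (hf n).aestronglyMeasurable)
    (h.mono fun _ hx => hx.tendsto)

namespace MaxRewardMDP

/-! ### Convergence of the state laws under converging policies. -/

section Convergence

variable {S : Type*} [MeasurableSpace S] {ν : Measure S} {m : ℕ} (M : MaxRewardMDP S ν m)

lemma measurable_density (s : S) (a : EuclideanSpace ℝ (Fin m)) : Measurable (M.P s a) := by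
  have h : Measurable fun s' : S => (s, a, s') := by fun_prop
  exact M.measurable_P.comp h

lemma integrable_density (s : S) {a : EuclideanSpace ℝ (Fin m)} (ha : a ∈ M.act) :
    Integrable (fun s' => (M.P s a s' : ℝ)) ν := by
  refine ⟨(M.measurable_density s a).coe_nnreal_real.aestronglyMeasurable, ?_⟩
  simp [HasFiniteIntegral, M.lintegral_P s a ha]

lemma integral_density (s : S) {a : EuclideanSpace ℝ (Fin m)} (ha : a ∈ M.act) :
    ∫ s', (M.P s a s' : ℝ) ∂ν = 1 := by
  rw [integral_eq_lintegral_of_nonneg_ae (ae_of_all _ fun _ => NNReal.coe_nonneg _)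
    (M.measurable_density s a).coe_nnreal_real.aestronglyMeasurable]
  simp [M.lintegral_P s a ha]

lemma integral_nextState (s : S) (a : EuclideanSpace ℝ (Fin m)) (f : S → ℝ) :
    ∫ s', f s' ∂(M.nextState s a) = ∫ s', (M.P s a s' : ℝ) * f s' ∂ν := by
  rw [nextState, integral_withDensity_eq_integral_smul (M.measurable_density s a)]
  rfl

/-- Two changes are separated. Replacing the density by its limit costs at most `B` times the `L¹`
distance, which tends to zero by Scheffé. Under the fixed limit law, continuity of the reward makes
the auxiliary variables converge for almost every next state, and dominated convergence applies. -/
lemma tendsto_integral_extTransition (s : S) {y : ℕ → ℝ} {y₀ : ℝ}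
    {a : ℕ → EuclideanSpace ℝ (Fin m)} {a₀ : EuclideanSpace ℝ (Fin m)} (ha : ∀ n, a n ∈ M.act)
    (ha₀ : a₀ ∈ M.act) (hy : Tendsto y atTop (𝓝 y₀)) (hat : Tendsto a atTop (𝓝 a₀))
    (hP : ∀ᵐ s' ∂ν, ContinuousAt (fun a' => M.P s a' s') a₀)
    (hR : ∀ᵐ s' ∂ν, ContinuousAt (fun a' => M.R s a' s') a₀)
    {f : ℕ → S × ℝ → ℝ} {g : S × ℝ → ℝ} {B : ℝ} (hf : ∀ n, Measurable (f n))
    (hB : ∀ n x, ‖f n x‖ ≤ B) (hfg : ∀ᵐ x ∂(M.extTransition s y₀ a₀), TendstoAlongSnd f g x) :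
    Tendsto (fun n => ∫ x, f n x ∂(M.extTransition s (y n) (a n))) atTop
      (𝓝 (∫ x, g x ∂(M.extTransition s y₀ a₀))) := by
  have := M.isProbabilityMeasure_nextState s ha₀
  have hg := aestronglyMeasurable_of_tendstoAlongSnd hf hfg
  set F : ℕ → S → ℝ := fun n s' => f n (s', M.nextAux s (y n) (a n) s') with hF
  have hFm : ∀ n, Measurable (F n) := fun n =>
    (hf n).comp (measurable_id.prodMk (M.measurable_nextAux s (y n) (a n)))
  have hlim : Tendsto (fun n => ∫ s', F n s' ∂(M.nextState s a₀)) atTop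
      (𝓝 (∫ s', g (s', M.nextAux s y₀ a₀ s') ∂(M.nextState s a₀))) := by
    refine tendsto_integral_of_dominated_convergence (fun _ => B)
      (fun n => (hFm n).aestronglyMeasurable) (integrable_const _)
      (fun n => ae_of_all _ fun s' => hB n _) ?_
    have h₁ : ∀ᵐ s' ∂(M.nextState s a₀), ContinuousAt (fun a' => M.R s a' s') a₀ :=
      (withDensity_absolutelyContinuous _ _).ae_le hR
    have h₂ := ae_of_ae_map
      (measurable_id.prodMk (M.measurable_nextAux s y₀ a₀)).aemeasurable hfg
    filter_upwards [h₁, h₂] with s' h₁ h₂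
    refine h₂ (fun n => M.nextAux s (y n) (a n) s') ?_
    exact ((h₁.tendsto.comp hat).max hy).div_const _
  have hdens : Tendsto (fun n => ∫ s', |(M.P s (a n) s' : ℝ) - M.P s a₀ s'| ∂ν) atTop (𝓝 0) := by
    refine tendsto_integral_abs_sub_of_integral_eq (fun n => M.integrable_density s (ha n))
      (M.integrable_density s ha₀) (fun n s' => NNReal.coe_nonneg _)
      (fun n => by rw [M.integral_density s (ha n), M.integral_density s ha₀]) ?_
    filter_upwards [hP] with s' hs'
    exact (NNReal.continuous_coe.tendsto _).comp (hs'.tendsto.comp hat)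
  have hint : ∀ n, ∀ a' ∈ M.act, Integrable (fun s' => (M.P s a' s' : ℝ) * F n s') ν :=
    fun n a' ha' => (M.integrable_density s ha').mul_bdd (c := B) (hFm n).aestronglyMeasurable
      (ae_of_all _ fun s' => hB n _)
  have hdiff : Tendsto (fun n => ∫ s', F n s' ∂(M.nextState s (a n)) -
      ∫ s', F n s' ∂(M.nextState s a₀)) atTop (𝓝 0) := by
    refine squeeze_zero_norm (fun n => ?_) (by simpa using hdens.const_mul B)
    rw [integral_nextState, integral_nextState, ← integral_sub (hint n _ (ha n)) (hint n _ ha₀),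
      ← integral_const_mul]
    refine norm_integral_le_of_norm_le
      (((M.integrable_density s (ha n)).sub (M.integrable_density s ha₀)).abs.const_mul B)
      (ae_of_all _ fun s' => ?_)
    rw [← sub_mul, norm_mul, mul_comm]
    exact mul_le_mul_of_nonneg_right (hB n _) (abs_nonneg _)
  rw [M.integral_extTransition s y₀ a₀ hg]
  simpa [M.integral_extTransition s _ _ (hf _).aestronglyMeasurable, hF] using hdiff.add hlim

variable [SigmaFinite ν]

/-- If the policies `π n` converge to `π₀`, the laws of the extended state converge: integrals of
bounded functions that converge under perturbations of the auxiliary variable converge. -/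
lemma tendsto_integral_stateLaw {π : ℕ → M.Policy} {π₀ : M.Policy}
    (hπ : ∀ x, TendstoAlongSnd (fun n => π n) π₀ x)
    (hP : ∀ s, ∀ a ∈ M.act, ∀ᵐ s' ∂ν, ContinuousAt (fun a' => M.P s a' s') a)
    (hR : ∀ s, ∀ a ∈ M.act, ∀ᵐ s' ∂ν, ContinuousAt (fun a' => M.R s a' s') a) (t : ℕ)
    {f : ℕ → S × ℝ → ℝ} {g : S × ℝ → ℝ} {B : ℝ} (hf : ∀ n, Measurable (f n))
    (hB : ∀ n x, ‖f n x‖ ≤ B) (hfg : ∀ᵐ x ∂(M.stateLaw π₀ t), TendstoAlongSnd f g x) :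
    Tendsto (fun n => ∫ x, f n x ∂(M.stateLaw (π n) t)) atTop
      (𝓝 (∫ x, g x ∂(M.stateLaw π₀ t))) := by
  induction t generalizing f g with
  | zero =>
    simp only [stateLaw_zero] at hfg ⊢
    exact tendsto_integral_of_dominated_convergence (fun _ => B)
      (fun n => (hf n).aestronglyMeasurable) (integrable_const _)
      (fun n => ae_of_all _ (hB n)) (hfg.mono fun _ hx => hx.tendsto)
  | succ t ih =>
    have hg := aestronglyMeasurable_of_tendstoAlongSnd hf hfg
    have hgB : ∀ᵐ x ∂(M.stateLaw π₀ (t + 1)), ‖g x‖ ≤ B := hfg.mono fun x hx =>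
      le_of_tendsto hx.tendsto.norm (Eventually.of_forall fun n => hB n x)
    have hgi : Integrable g (M.stateLaw π₀ (t + 1)) := Integrable.of_bound hg B hgB
    have hfi : ∀ n, Integrable (f n) (M.stateLaw (π n) (t + 1)) := fun n =>
      Integrable.of_bound (hf n).aestronglyMeasurable B (ae_of_all _ (hB n))
    simp only [stateLaw_succ] at hfg hgi hfi ⊢
    rw [integral_measure_comp hgi]
    simp only [fun n => integral_measure_comp (hfi n)]
    -- The induction hypothesis is used for the one-step integrals of `f n` and `g`; this is why `f`
    -- and `g` are generalized. Their convergence under perturbed `y` is the one-step lemma.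
    refine ih (fun n => ?_) (fun n => norm_integral_kernel_le _ (hB n)) ?_
    · exact (((hf n).comp measurable_snd).stronglyMeasurable.integral_kernel_prod_right'
        (κ := M.onPolicy (π n))).measurable
    · filter_upwards [Measure.ae_ae_of_ae_comp hfg] with x hx y hy
      exact M.tendsto_integral_extTransition x.1 (fun n => (π n).mem_act _) (π₀.mem_act x) hy
        (hπ x y hy) (hP _ _ (π₀.mem_act x)) (hR _ _ (π₀.mem_act x)) hf hB hx

end Convergence

end MaxRewardMDP

/-- Joint differentiation of a function with a converging parameter: difference quotients between
two points converging to the base point converge to the derivative at the limiting direction. -/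
lemma tendsto_parametric_difference_quotient {E F : Type*} [NormedAddCommGroup E]
    [NormedSpace ℝ E] [NormedAddCommGroup F] [NormedSpace ℝ F] {Φ : E → ℝ → F} {e₀ : E} {y₀ : ℝ}
    (hdiff : ∀ᶠ z : E × ℝ in 𝓝 (e₀, y₀), DifferentiableAt ℝ (fun e => Φ e z.2) z.1)
    (hcont : ContinuousAt (fun z : E × ℝ => fderiv ℝ (fun e => Φ e z.2) z.1) (e₀, y₀))
    {e e' : ℕ → E} {y : ℕ → ℝ} {c : ℕ → ℝ} {w : E}
    (he : Tendsto e atTop (𝓝 e₀)) (he' : Tendsto e' atTop (𝓝 e₀)) (hy : Tendsto y atTop (𝓝 y₀))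
    (hw : Tendsto (fun n => c n • (e n - e' n)) atTop (𝓝 w)) :
    Tendsto (fun n => c n • (Φ (e n) (y n) - Φ (e' n) (y n))) atTop
      (𝓝 (fderiv ℝ (fun e => Φ e y₀) e₀ w)) := by
  set A := fderiv ℝ (fun e => Φ e y₀) e₀ with hA
  have hO : (fun n => Φ (e n) (y n) - Φ (e' n) (y n) - A (e n - e' n)) =o[atTop]
      fun n => e n - e' n := by
    refine Asymptotics.isLittleO_iff.2 fun ε hε => ?_
    -- A product ball around the base point gives a mean value inequality on a convex ball that is
    -- uniform in `y`.
    have h₁ : ∀ᶠ z : E × ℝ in 𝓝 (e₀, y₀), DifferentiableAt ℝ (fun e => Φ e z.2) z.1 ∧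
        ‖fderiv ℝ (fun e => Φ e z.2) z.1 - A‖ ≤ ε := by
      refine hdiff.and ?_
      filter_upwards [hcont (Metric.ball_mem_nhds _ hε)] with z hz
      exact (mem_ball_iff_norm.1 hz).le
    obtain ⟨δ, hδ, hball⟩ := Metric.eventually_nhds_iff_ball.1 h₁
    filter_upwards [he (Metric.ball_mem_nhds _ hδ), he' (Metric.ball_mem_nhds _ hδ),
      hy (Metric.ball_mem_nhds _ hδ)] with n hn hn' hyn
    have hz : ∀ x ∈ Metric.ball e₀ δ, (x, y n) ∈ Metric.ball (e₀, y₀) δ := fun x hx => by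
      rw [← ball_prod_same]
      exact ⟨hx, hyn⟩
    exact Convex.norm_image_sub_le_of_norm_fderiv_le' (f := fun e => Φ e (y n))
      (fun x hx => (hball _ (hz x hx)).1) (fun x hx => (hball _ (hz x hx)).2)
      (convex_ball e₀ δ) hn' hn
  -- The scaled differences converge, hence are bounded, so the scaled error tends to zero.
  have hO₂ : (fun n => c n • (Φ (e n) (y n) - Φ (e' n) (y n) - A (e n - e' n))) =o[atTop]
      fun _ => (1 : ℝ) :=
    ((Asymptotics.isBigO_refl c atTop).smul_isLittleO hO).trans_isBigO (hw.isBigO_one ℝ)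
  have h := ((Asymptotics.isLittleO_one_iff ℝ).1 hO₂).add ((A.continuous.tendsto w).comp hw)
  rw [zero_add] at h
  refine h.congr fun n => ?_
  simp only [Function.comp_apply, map_smul, ← smul_add, sub_add_cancel]

namespace MaxRewardMDP

/-! ### Differentiation of the objective. -/

section Gradient

variable {S : Type*} [MeasurableSpace S] {ν : Measure S} [SigmaFinite ν] {m p : ℕ}
  (M : MaxRewardMDP S ν m) {μ : EuclideanSpace ℝ (Fin p) → M.Policy}
  {θ : EuclideanSpace ℝ (Fin p)}

lemma exists_abs_advantage_le
    (hLip : ∃ ε > 0, ∃ L : ℝ, ∀ s, ∀ y ∈ Set.Icc 0 M.Rbar,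
      (∀ θ' ∈ Metric.ball θ ε, ‖μ θ' (s, y) - μ θ (s, y)‖ ≤ L * ‖θ' - θ‖) ∧
      (∀ a ∈ M.act ∩ Metric.ball (μ θ (s, y)) ε,
        |M.qhat (μ θ) s a y - M.qhat (μ θ) s (μ θ (s, y)) y| ≤ L * ‖a - μ θ (s, y)‖)) :
    ∃ δ > 0, ∃ C : ℝ, ∀ θ' ∈ Metric.ball θ δ, ∀ x : S × ℝ, 0 ≤ x.2 →
      |M.advantage (μ θ) (μ θ') x| ≤ C * ‖θ' - θ‖ := by
  obtain ⟨ε, hε, L, hL⟩ := hLip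
  have hL₁ : 0 < |L| + 1 := by positivity
  -- The second radius keeps the perturbed action within `ε` of the original one, where the bound on
  -- `q̂` is available; adding `1` covers `L = 0`.
  refine ⟨min ε (ε / (|L| + 1)), lt_min hε (div_pos hε hL₁), |L| * |L|, fun θ' hθ' x hx => ?_⟩
  rcases le_or_gt x.2 M.Rbar with hy | hy
  · obtain ⟨h₁, h₂⟩ := hL x.1 x.2 ⟨hx, hy⟩
    have hd := mem_ball_iff_norm.1 hθ'
    have hμ : ‖μ θ' x - μ θ x‖ ≤ |L| * ‖θ' - θ‖ :=
      (h₁ θ' (Metric.ball_subset_ball (min_le_left _ _) hθ')).trans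
        (mul_le_mul_of_nonneg_right (le_abs_self L) (norm_nonneg _))
    have hlt : ‖μ θ' x - μ θ x‖ < ε := by
      have h₃ := (lt_div_iff₀ hL₁).1 (hd.trans_le (min_le_right _ _))
      have h₄ := norm_nonneg (θ' - θ)
      nlinarith [hμ]
    have hq := h₂ (μ θ' x) ⟨(μ θ').mem_act x, mem_ball_iff_norm.2 hlt⟩
    rw [advantage, ← qhat_policy]
    calc _ ≤ L * ‖μ θ' x - μ θ x‖ := hq
      _ ≤ |L| * ‖μ θ' x - μ θ x‖ := mul_le_mul_of_nonneg_right (le_abs_self L) (norm_nonneg _)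
      _ ≤ |L| * (|L| * ‖θ' - θ‖) := mul_le_mul_of_nonneg_left hμ (abs_nonneg L)
      _ = _ := by ring
  · rw [advantage, M.qhat_of_Rbar_le _ _ ((μ θ').mem_act x) hy.le, M.extValue_of_Rbar_le _ hy.le,
      sub_self, abs_zero]
    positivity

/-- The normalized advantage, with the auxiliary variable clipped at zero. -/
noncomputable def advantageQuotient (μ : EuclideanSpace ℝ (Fin p) → M.Policy)
    (θ θ' : EuclideanSpace ℝ (Fin p)) (x : S × ℝ) : ℝ :=
  ‖θ' - θ‖⁻¹ * M.advantage (μ θ) (μ θ') (x.1, max x.2 0)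

lemma measurable_advantageQuotient (θ' : EuclideanSpace ℝ (Fin p)) :
    Measurable (M.advantageQuotient μ θ θ') :=
  ((M.measurable_advantage (μ θ) (μ θ')).comp
    (measurable_fst.prodMk (measurable_snd.max measurable_const))).const_mul _

/-- Clipping makes the bound valid at every point, as the convergence theorem for the laws requires;
it changes nothing on visited states, where `y ≥ 0`. -/
lemma norm_advantageQuotient_le {δ C : ℝ}
    (hC : ∀ θ' ∈ Metric.ball θ δ, ∀ x : S × ℝ, 0 ≤ x.2 →
      |M.advantage (μ θ) (μ θ') x| ≤ C * ‖θ' - θ‖)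
    {θ' : EuclideanSpace ℝ (Fin p)} (hθ' : θ' ∈ Metric.ball θ δ) (hne : θ' ≠ θ) (x : S × ℝ) :
    ‖M.advantageQuotient μ θ θ' x‖ ≤ C := by
  have hpos : 0 < ‖θ' - θ‖ := norm_sub_pos_iff.2 hne
  rw [advantageQuotient, norm_mul, norm_inv, norm_norm, inv_mul_le_iff₀ hpos, mul_comm]
  exact hC θ' hθ' _ (le_max_right _ _)

lemma inner_gradIntegrand (x : S × ℝ) (u : EuclideanSpace ℝ (Fin p)) :
    inner ℝ (M.gradIntegrand μ θ x) u =
      fderiv ℝ (fun a => M.qhat (μ θ) x.1 a x.2) (μ θ x)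
        (fderiv ℝ (fun θ' => μ θ' x) θ u) := by
  rw [gradIntegrand, ContinuousLinearMap.adjoint_inner_left, ← toDual_gradient,
    InnerProductSpace.toDual_apply_apply]

lemma tendstoAlongSnd_advantageQuotient {x : S × ℝ} (hx : 0 ≤ x.2)
    (hμ : ContinuousAt (fun z : EuclideanSpace ℝ (Fin p) × ℝ => μ z.1 (x.1, z.2)) (θ, x.2))
    (hμ' : (∀ᶠ z : EuclideanSpace ℝ (Fin p) × ℝ in 𝓝 (θ, x.2),
        DifferentiableAt ℝ (fun θ' => μ θ' (x.1, z.2)) z.1) ∧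
      ContinuousAt (fun z : EuclideanSpace ℝ (Fin p) × ℝ =>
        fderiv ℝ (fun θ' => μ θ' (x.1, z.2)) z.1) (θ, x.2))
    (hq' : (∀ᶠ z : EuclideanSpace ℝ (Fin m) × ℝ in 𝓝 (μ θ x, x.2),
        DifferentiableAt ℝ (fun a => M.qhat (μ θ) x.1 a z.2) z.1) ∧
      ContinuousAt (fun z : EuclideanSpace ℝ (Fin m) × ℝ =>
        ∇ (fun a => M.qhat (μ θ) x.1 a z.2) z.1) (μ θ x, x.2))
    {θs : ℕ → EuclideanSpace ℝ (Fin p)} {u : EuclideanSpace ℝ (Fin p)}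
    (hθs : Tendsto θs atTop (𝓝 θ))
    (hu : Tendsto (fun n => ‖θs n - θ‖⁻¹ • (θs n - θ)) atTop (𝓝 u)) :
    TendstoAlongSnd (fun n => M.advantageQuotient μ θ (θs n))
      (fun x => inner ℝ (M.gradIntegrand μ θ x) u) x := by
  intro y hy
  have hz : Tendsto (fun n => max (y n) 0) atTop (𝓝 x.2) := by
    simpa [max_eq_left hx] using hy.max (tendsto_const_nhds (x := (0 : ℝ)))
  have hpol := tendsto_parametric_difference_quotient (Φ := fun θ' z => μ θ' (x.1, z)) hμ'.1 hμ'.2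
    hθs tendsto_const_nhds hz hu
  have hcont : ContinuousAt (fun z : EuclideanSpace ℝ (Fin m) × ℝ =>
      fderiv ℝ (fun a => M.qhat (μ θ) x.1 a z.2) z.1) (μ θ x, x.2) := by
    simp_rw [← toDual_gradient]
    exact (InnerProductSpace.toDual ℝ _).continuous.continuousAt.comp hq'.2
  have ha : Tendsto (fun n => μ (θs n) (x.1, max (y n) 0)) atTop (𝓝 (μ θ x)) :=
    hμ.tendsto.comp (hθs.prodMk_nhds hz)
  have ha' : Tendsto (fun n => μ θ (x.1, max (y n) 0)) atTop (𝓝 (μ θ x)) :=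
    hμ.tendsto.comp (tendsto_const_nhds.prodMk_nhds hz)
  -- Chain rule for difference quotients: `hpol`, the limit of the scaled policy increments,
  -- supplies the direction for `q̂`.
  have h := tendsto_parametric_difference_quotient (Φ := fun a z => M.qhat (μ θ) x.1 a z) hq'.1
    hcont ha ha' hz hpol
  show Tendsto _ _ (𝓝 (inner ℝ (M.gradIntegrand μ θ x) u))
  rw [inner_gradIntegrand]
  refine h.congr fun n => ?_
  show _ = M.advantageQuotient μ θ (θs n) (x.1, y n)
  rw [advantageQuotient, advantage, ← qhat_policy]
  rfl

/-- Along a sequence approaching `θ` in direction `u`, the inner product is an almost everywhere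
limit of measurable functions bounded by `C`, and the measure is finite. -/
lemma integrable_inner_gradIntegrand {δ C : ℝ} (hδ : 0 < δ)
    (hC : ∀ θ' ∈ Metric.ball θ δ, ∀ x : S × ℝ, 0 ≤ x.2 →
      |M.advantage (μ θ) (μ θ') x| ≤ C * ‖θ' - θ‖)
    (hlim : ∀ (θs : ℕ → EuclideanSpace ℝ (Fin p)) (u : EuclideanSpace ℝ (Fin p)),
      Tendsto θs atTop (𝓝 θ) → Tendsto (fun n => ‖θs n - θ‖⁻¹ • (θs n - θ)) atTop (𝓝 u) →
      ∀ᵐ x ∂(M.dhat (μ θ)), TendstoAlongSnd (fun n => M.advantageQuotient μ θ (θs n))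
        (fun x => inner ℝ (M.gradIntegrand μ θ x) u) x)
    {u : EuclideanSpace ℝ (Fin p)} (hu : ‖u‖ = 1) :
    Integrable (fun x => inner ℝ (M.gradIntegrand μ θ x) u) (M.dhat (μ θ)) := by
  -- The exponent `n + 1` keeps even the first point strictly inside the ball of radius `δ`.
  set c : ℕ → ℝ := fun n => δ * (1 / 2) ^ (n + 1) with hc
  have hcpos : ∀ n, 0 < c n := fun n => by positivity
  have hnorm : ∀ n, ‖c n • u‖ = c n := fun n => by
    rw [norm_smul, hu, mul_one, Real.norm_of_nonneg (hcpos n).le]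
  have hclim : Tendsto c atTop (𝓝 0) := by
    have h := (tendsto_add_atTop_iff_nat 1).2
      (tendsto_pow_atTop_nhds_zero_of_lt_one (r := (1 / 2 : ℝ)) (by norm_num) (by norm_num))
    simpa only [mul_zero] using h.const_mul δ
  have hθs : Tendsto (fun n => θ + c n • u) atTop (𝓝 θ) := by
    simpa using (hclim.smul_const u).const_add θ
  have hdir : Tendsto (fun n => ‖θ + c n • u - θ‖⁻¹ • (θ + c n • u - θ)) atTop (𝓝 u) := by
    refine tendsto_const_nhds.congr fun n => ?_
    rw [add_sub_cancel_left, hnorm, smul_smul, inv_mul_cancel₀ (hcpos n).ne', one_smul]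
  have h := hlim _ u hθs hdir
  refine Integrable.of_bound (aestronglyMeasurable_of_tendstoAlongSnd
    (fun n => M.measurable_advantageQuotient _) h) C (h.mono fun x hx =>
      le_of_tendsto hx.tendsto.norm (Eventually.of_forall fun n => ?_))
  refine M.norm_advantageQuotient_le hC ?_ ?_ x
  · rw [mem_ball_iff_norm, add_sub_cancel_left, hnorm]
    refine mul_lt_of_lt_one_right hδ (pow_lt_one₀ (by norm_num) (by norm_num) (by omega))
  · rw [← sub_ne_zero, add_sub_cancel_left, ← norm_ne_zero_iff, hnorm]
    exact (hcpos n).ne'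

/-- The performance difference series is passed to the limit term by term, dominated by `γ ^ t * C`;
the limits reassemble into the integral against `dhat`. -/
lemma tendsto_objective_quotient {δ C : ℝ}
    (hC : ∀ θ' ∈ Metric.ball θ δ, ∀ x : S × ℝ, 0 ≤ x.2 →
      |M.advantage (μ θ) (μ θ') x| ≤ C * ‖θ' - θ‖)
    (hP : ∀ s, ∀ a ∈ M.act, ∀ᵐ s' ∂ν, ContinuousAt (fun a' => M.P s a' s') a)
    (hR : ∀ s, ∀ a ∈ M.act, ∀ᵐ s' ∂ν, ContinuousAt (fun a' => M.R s a' s') a)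
    {θs : ℕ → EuclideanSpace ℝ (Fin p)} {u : EuclideanSpace ℝ (Fin p)}
    (hball : ∀ n, θs n ∈ Metric.ball θ δ) (hne : ∀ n, θs n ≠ θ)
    (hμ : ∀ x, TendstoAlongSnd (fun n => μ (θs n)) (μ θ) x)
    (hlim : ∀ᵐ x ∂(M.dhat (μ θ)), TendstoAlongSnd (fun n => M.advantageQuotient μ θ (θs n))
        (fun x => inner ℝ (M.gradIntegrand μ θ x) u) x)
    (hint : Integrable (fun x => inner ℝ (M.gradIntegrand μ θ x) u) (M.dhat (μ θ))) :
    Tendsto (fun n => ‖θs n - θ‖⁻¹ * (M.objective (μ (θs n)) - M.objective (μ θ))) atTop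
      (𝓝 (∫ x, inner ℝ (M.gradIntegrand μ θ x) u ∂(M.dhat (μ θ)))) := by
  have hγ := M.γ_pos
  have hbound : ∀ n x, ‖M.advantageQuotient μ θ (θs n) x‖ ≤ C := fun n x =>
    M.norm_advantageQuotient_le hC (hball n) (hne n) x
  have hterm : ∀ t, Tendsto
      (fun n => M.γ ^ t * ∫ x, M.advantageQuotient μ θ (θs n) x ∂(M.stateLaw (μ (θs n)) t)) atTop
      (𝓝 (M.γ ^ t * ∫ x, inner ℝ (M.gradIntegrand μ θ x) u ∂(M.stateLaw (μ θ) t))) := fun t =>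
    (M.tendsto_integral_stateLaw hμ hP hR t (fun n => M.measurable_advantageQuotient _) hbound
      ((M.ae_dhat_iff _).1 hlim t)).const_mul _
  have hdom : ∀ n t, ‖M.γ ^ t *
      ∫ x, M.advantageQuotient μ θ (θs n) x ∂(M.stateLaw (μ (θs n)) t)‖ ≤ M.γ ^ t * C := by
    intro n t
    rw [norm_mul, norm_pow, Real.norm_of_nonneg hγ.le]
    refine mul_le_mul_of_nonneg_left ?_ (pow_nonneg hγ.le t)
    simpa using norm_integral_le_of_norm_le_const (μ := M.stateLaw (μ (θs n)) t)
      (f := M.advantageQuotient μ θ (θs n)) (ae_of_all _ (hbound n))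
  have hsum := tendsto_tsum_of_dominated_convergence
    ((summable_geometric_of_lt_one hγ.le M.γ_lt_one).mul_right C) hterm
    (Eventually.of_forall hdom)
  rw [M.integral_dhat _ hint]
  refine hsum.congr fun n => ?_
  rw [M.objective_sub_eq_tsum (μ θ) (μ (θs n)) (hC _ (hball n)), ← tsum_mul_left]
  refine tsum_congr fun t => ?_
  have h : ∫ x, M.advantageQuotient μ θ (θs n) x ∂(M.stateLaw (μ (θs n)) t) =
      ‖θs n - θ‖⁻¹ * ∫ x, M.advantage (μ θ) (μ (θs n)) x ∂(M.stateLaw (μ (θs n)) t) := by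
    rw [← integral_const_mul]
    refine integral_congr_ae ?_
    filter_upwards [M.ae_stateLaw_nonneg (μ (θs n)) t] with x hx
    rw [advantageQuotient, max_eq_left hx]
  rw [h, mul_left_comm]

lemma integrable_of_integrable_inner {α : Type*} [MeasurableSpace α] {ρ : Measure α}
    {G : α → EuclideanSpace ℝ (Fin p)}
    (hG : ∀ u : EuclideanSpace ℝ (Fin p), ‖u‖ = 1 → Integrable (fun x => inner ℝ (G x) u) ρ) :
    Integrable G ρ := by
  set b := EuclideanSpace.basisFun (Fin p) ℝ
  have h : G = fun x => ∑ i, inner ℝ (G x) (b i) • b i := by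
    funext x
    conv_lhs => rw [← b.sum_repr' (G x)]
    simp_rw [real_inner_comm]
  rw [h]
  exact integrable_finsetSum _ fun i _ => (hG (b i) (b.norm_eq_one i)).smul_const _

/-- The deterministic policy gradient theorem for max-reward objectives. -/
lemma integrable_gradIntegrand_and_hasGradientAt
    (hP : ∀ s, ∀ a ∈ M.act, ∀ᵐ s' ∂ν, ContinuousAt (fun a' => M.P s a' s') a)
    (hR : ∀ s, ∀ a ∈ M.act, ∀ᵐ s' ∂ν, ContinuousAt (fun a' => M.R s a' s') a)
    (hμ : ∀ s y, ContinuousAt (fun z : EuclideanSpace ℝ (Fin p) × ℝ => μ z.1 (s, z.2)) (θ, y))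
    (hLip : ∃ ε > 0, ∃ L : ℝ, ∀ s, ∀ y ∈ Set.Icc 0 M.Rbar,
      (∀ θ' ∈ Metric.ball θ ε, ‖μ θ' (s, y) - μ θ (s, y)‖ ≤ L * ‖θ' - θ‖) ∧
      (∀ a ∈ M.act ∩ Metric.ball (μ θ (s, y)) ε,
        |M.qhat (μ θ) s a y - M.qhat (μ θ) s (μ θ (s, y)) y| ≤ L * ‖a - μ θ (s, y)‖))
    (hμ' : ∀ᵐ x ∂(M.dhat (μ θ)),
      (∀ᶠ z : EuclideanSpace ℝ (Fin p) × ℝ in 𝓝 (θ, x.2),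
        DifferentiableAt ℝ (fun θ' => μ θ' (x.1, z.2)) z.1) ∧
      ContinuousAt (fun z : EuclideanSpace ℝ (Fin p) × ℝ =>
        fderiv ℝ (fun θ' => μ θ' (x.1, z.2)) z.1) (θ, x.2))
    (hq' : ∀ᵐ x ∂(M.dhat (μ θ)),
      (∀ᶠ z : EuclideanSpace ℝ (Fin m) × ℝ in 𝓝 (μ θ x, x.2),
        DifferentiableAt ℝ (fun a => M.qhat (μ θ) x.1 a z.2) z.1) ∧
      ContinuousAt (fun z : EuclideanSpace ℝ (Fin m) × ℝ =>
        ∇ (fun a => M.qhat (μ θ) x.1 a z.2) z.1) (μ θ x, x.2)) :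
    Integrable (M.gradIntegrand μ θ) (M.dhat (μ θ)) ∧
    HasGradientAt (fun θ' => M.objective (μ θ'))
      (∫ x, M.gradIntegrand μ θ x ∂(M.dhat (μ θ))) θ := by
  obtain ⟨δ, hδ, C, hC⟩ := M.exists_abs_advantage_le hLip
  have hlim : ∀ (θs : ℕ → EuclideanSpace ℝ (Fin p)) (u : EuclideanSpace ℝ (Fin p)),
      Tendsto θs atTop (𝓝 θ) → Tendsto (fun n => ‖θs n - θ‖⁻¹ • (θs n - θ)) atTop (𝓝 u) →
      ∀ᵐ x ∂(M.dhat (μ θ)), TendstoAlongSnd (fun n => M.advantageQuotient μ θ (θs n))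
        (fun x => inner ℝ (M.gradIntegrand μ θ x) u) x := by
    intro θs u hθs hu
    have hnn : ∀ᵐ x ∂(M.dhat (μ θ)), 0 ≤ x.2 :=
      (M.ae_dhat_iff _).2 fun t => M.ae_stateLaw_nonneg _ t
    filter_upwards [hμ', hq', hnn] with x h₁ h₂ h₃
    exact M.tendstoAlongSnd_advantageQuotient h₃ (hμ x.1 x.2) h₁ h₂ hθs hu
  have hinner : ∀ u : EuclideanSpace ℝ (Fin p), ‖u‖ = 1 →
      Integrable (fun x => inner ℝ (M.gradIntegrand μ θ x) u) (M.dhat (μ θ)) := fun u hu =>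
    M.integrable_inner_gradIntegrand hδ hC hlim hu
  have hint := integrable_of_integrable_inner hinner
  refine ⟨hint, ?_⟩
  rw [hasGradientAt_iff_hasFDerivAt, ← hasFDerivWithinAt_univ,
    ← hasFDerivWithinAt_sdiff_singleton_self, hasFDerivWithinAt_iff_tendsto]
  -- It suffices to find, in every sequence tending to `θ` through other points, a subsequence along
  -- which the remainder quotient vanishes. Compactness of the sphere provides one with converging
  -- directions.
  refine tendsto_of_subseq_tendsto fun ns hns => ?_
  obtain ⟨hns, hmem⟩ := tendsto_nhdsWithin_iff.1 hns
  obtain ⟨N, hN⟩ := eventually_atTop.1 (hmem.and (hns (Metric.ball_mem_nhds θ hδ)))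
  have hne : ∀ n, ns (n + N) ≠ θ := fun n => (hN _ (Nat.le_add_left N n)).1.2
  have hsphere : ∀ n, ‖ns (n + N) - θ‖⁻¹ • (ns (n + N) - θ) ∈
      Metric.sphere (0 : EuclideanSpace ℝ (Fin p)) 1 := fun n => by
    rw [mem_sphere_zero_iff_norm, norm_smul, norm_inv, norm_norm,
      inv_mul_cancel₀ (norm_ne_zero_iff.2 (sub_ne_zero.2 (hne n)))]
  obtain ⟨u, hu, φ, hφ, hdir⟩ := (isCompact_sphere _ _).tendsto_subseq hsphere
  refine ⟨fun n => φ n + N, ?_⟩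
  set θs : ℕ → EuclideanSpace ℝ (Fin p) := fun n => ns (φ n + N) with hθs_def
  have hθs : Tendsto θs atTop (𝓝 θ) :=
    hns.comp ((tendsto_add_atTop_nat N).comp hφ.tendsto_atTop)
  have hu₁ : ‖u‖ = 1 := mem_sphere_zero_iff_norm.1 hu
  have hobj := M.tendsto_objective_quotient hC hP hR (θs := θs)
    (fun n => (hN _ (Nat.le_add_left N _)).2) (fun n => hne _)
    (fun x y hy => (hμ x.1 x.2).tendsto.comp (hθs.prodMk_nhds hy)) (hlim θs u hθs hdir)
    (hinner u hu₁)
  set I := ∫ x, M.gradIntegrand μ θ x ∂(M.dhat (μ θ)) with hI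
  have hIu : ∫ x, inner ℝ (M.gradIntegrand μ θ x) u ∂(M.dhat (μ θ)) = inner ℝ I u := by
    simp_rw [fun v => real_inner_comm u v]
    rw [hI, integral_inner hint]
  rw [hIu] at hobj
  -- The objective quotient and the linear term have the same limit `⟪I, u⟫`; the remainder quotient
  -- is the norm of their difference.
  have hlin : Tendsto (fun n => inner ℝ I (‖θs n - θ‖⁻¹ • (θs n - θ))) atTop (𝓝 (inner ℝ I u)) :=
    tendsto_const_nhds.inner hdir
  have h := (hobj.sub hlin).norm
  rw [sub_self, norm_zero] at h
  refine h.congr fun n => ?_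
  rw [inner_smul_right, ← mul_sub, norm_mul, norm_inv, norm_norm,
    InnerProductSpace.toDual_apply_apply]

end Gradient

end MaxRewardMDP

theorem corollary1 {S : Type*} [MeasurableSpace S] (ν : Measure S) [SigmaFinite ν] {m p : ℕ}
    (M : MaxRewardMDP S ν m)
    -- a parameterized deterministic extended policy, and the parameter at which one differentiates
    (μ : EuclideanSpace ℝ (Fin p) → M.Policy) (θ : EuclideanSpace ℝ (Fin p))
    -- density and reward are continuous in the action, for almost every next state
    (hP : ∀ s, ∀ a ∈ M.act, ∀ᵐ s' ∂ν, ContinuousAt (fun a' => M.P s a' s') a)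
    (hR : ∀ s, ∀ a ∈ M.act, ∀ᵐ s' ∂ν, ContinuousAt (fun a' => M.R s a' s') a)
    -- the policy is continuous in the parameter and the auxiliary variable
    (hμ : ∀ s y, ContinuousAt (fun z : EuclideanSpace ℝ (Fin p) × ℝ => μ z.1 (s, z.2)) (θ, y))
    -- local Lipschitz bounds: policy in the parameter, action value in the action
    (hLip : ∃ ε > 0, ∃ L : ℝ, ∀ s, ∀ y ∈ Set.Icc 0 M.Rbar,
      (∀ θ' ∈ Metric.ball θ ε, ‖μ θ' (s, y) - μ θ (s, y)‖ ≤ L * ‖θ' - θ‖) ∧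
      (∀ a ∈ M.act ∩ Metric.ball (μ θ (s, y)) ε,
        |M.qhat (μ θ) s a y - M.qhat (μ θ) s (μ θ (s, y)) y| ≤ L * ‖a - μ θ (s, y)‖))
    -- the two gradients of the formula exist near almost every visited point, and are
    -- continuous there
    (hμ' : ∀ᵐ x ∂(M.dhat (μ θ)),
      (∀ᶠ z : EuclideanSpace ℝ (Fin p) × ℝ in 𝓝 (θ, x.2),
        DifferentiableAt ℝ (fun θ' => μ θ' (x.1, z.2)) z.1) ∧
      ContinuousAt (fun z : EuclideanSpace ℝ (Fin p) × ℝ =>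
        fderiv ℝ (fun θ' => μ θ' (x.1, z.2)) z.1) (θ, x.2))
    (hq' : ∀ᵐ x ∂(M.dhat (μ θ)),
      (∀ᶠ z : EuclideanSpace ℝ (Fin m) × ℝ in 𝓝 (μ θ x, x.2),
        DifferentiableAt ℝ (fun a => M.qhat (μ θ) x.1 a z.2) z.1) ∧
      ContinuousAt (fun z : EuclideanSpace ℝ (Fin m) × ℝ =>
        ∇ (fun a => M.qhat (μ θ) x.1 a z.2) z.1) (μ θ x, x.2)) :
    -- the total mass of the discounted stationary distribution
    M.dhat (μ θ) Set.univ = ENNReal.ofReal (1 - M.γ)⁻¹ ∧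
    Integrable (M.gradIntegrand μ θ) (M.dhat (μ θ)) ∧
    -- the gradient is the integral against the unnormalized distribution, and it is proportional,
    -- with the positive constant `1 / (1 - γ)`, to the expectation under the normalized one
    HasGradientAt (fun θ' => M.objective (μ θ'))
      (∫ x, M.gradIntegrand μ θ x ∂(M.dhat (μ θ))) θ ∧
    HasGradientAt (fun θ' => M.objective (μ θ'))
      ((1 - M.γ)⁻¹ • ∫ x, M.gradIntegrand μ θ x
        ∂((M.dhat (μ θ) Set.univ)⁻¹ • M.dhat (μ θ))) θ := by
  obtain ⟨hint, hgrad⟩ := M.integrable_gradIntegrand_and_hasGradientAt hP hR hμ hLip hμ' hq'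
  refine ⟨M.dhat_univ _, hint, hgrad, ?_⟩
  have h : (0 : ℝ) < (1 - M.γ)⁻¹ := inv_pos.2 (sub_pos.2 M.γ_lt_one)
  rw [M.dhat_univ, integral_smul_measure, ENNReal.toReal_inv, ENNReal.toReal_ofReal h.le,
    smul_smul, mul_inv_cancel₀ h.ne', one_smul]
  exact hgrad
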